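/- **Setting.** Let $W\in C^2(0,\infty)$ be nonnegative with $W(F)\to\infty$ as $F\searrow0$, $W(F)\to\gamma>0$ as $F\to\infty$, $W(1)=0$ and $W(F)>0$ for $F\ne1$. Put $W^*(H)=H\,W(1/H)$ for $H>0$ and $W^*(0)=0$, and assume $W^*\in C^2([0,\infty))$; write $S^*=dW^*/dH$ and $M^*=dS^*/dH$. Let $\epsilon,\lambda>0$, let $$\mathcal K=\{h\in H^2(0,\lambda):h(0)=0,\ h(\lambda)=1,\ h'\ge0\},\qquad E[h]=\int_0^\lambda\Big(\tfrac{\epsilon^2}{2}(h'')^2+W^*(h')\Big)dy .$$ For $h\in\mathcal K$ let $\mathcal B_h=\{y\in[0,\lambda]:h'(y)=0\}$, $\mathcal G_h=[0,\lambda]\setminus\mathcal B_h$, and let $\mathcal C_h$ be the set of crack faces, i.e. of the points $y_c\in\mathcal B_h$ such that $h'$ does not vanish identically on $[y_c-\alpha,y_c+\alpha]\cap[0,\lambda]$ for any $\alpha>0$. Assume that no crack face is degenerate: for every $y_c\in\mathcal C_h$ there is $\alpha>0$ with $[y_c,y_c+\alpha)\subseteq\mathcal B_h$ and $(y_c-\alpha,y_c)\subseteq\mathcal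 G_h$, or with $(y_c-\alpha,y_c]\subseteq\mathcal B_h$ and $(y_c,y_c+\alpha)\subseteq\mathcal G_h$. Let $h\in\mathcal K$ solve the Euler–Lagrange equation, i.e. there is a nonnegative Radon measure $\mu$ with $\operatorname{supp}\mu\subseteq\mathcal B_h$ and $$\int_0^\lambda\big(\epsilon^2h''\psi''+S^*(h')\psi'\big)dy=\int_{\mathcal B_h}\psi'\,d\mu\qquad\text{for all }\psi\in H^2(0,\lambda)\cap H^1_0(0,\lambda).$$ The admissible variations at $h$ (those compatible with $h'\ge0$ and with the irreversibility of cracks) are $$\mathcal V_h=\{\eta\in H^2(0,\lambda)\cap H^1_0(0,\lambda):\eta'\ge0\text{ on }\mathcal B_h,\ \eta=0\text{ on }\mathcal C_h\},$$ and $\mathcal S_h=\{\eta\in\mathcal V_h:\eta=\eta'=0\text{ on }\mathcal B_h\}$. The second variation is $\delta^2E[h;\eta,\eta]=\int_0^\lambda\big(\epsilon^2(\eta'')^2+M^*(h')(\eta')^2\big)dy$. We call $h$ locally stable if it is a local minimizer of $E$ under admissible variations: there is $\delta>0$ such that $E[g]\ge E[h]$ for all $g\in\mathcal K$ with $g-h\in\mathcal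 V_h$ and $\|g-h\|_{H^2(0,\lambda)}<\delta$. **Theorem (sufficient condition).** Let $G_i=(r_i,s_i)\subseteq\mathcal G_h$, $i=1,\dots,N$ ($N\ge 0$), be all the unbroken intervals with both end points $r_i<s_i$ in $\mathcal C_h$, and let $\xi_i$ equal $h'$ on $G_i$ and $0$ on $[0,\lambda]\setminus G_i$. Then $\xi_i\in\mathcal S_h$ for every $i$. If $\delta^2E[h;\eta,\eta]>0$ for all nonzero $\eta\in\mathcal S_h$ with $\int_0^\lambda\eta\,\xi_i\,dy=0$ for all $i=1,\dots,N$, then $h$ is locally stable. -/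

import Mathlib

open Set Filter Topology MeasureTheory

noncomputable section

namespace InverseFracture

/-! ### The stored energy and its inverse-deformation counterpart -/

/-- A stored-energy density of a brittle material: `W : (0,∞) → [0,∞)` is `C²`, blows up at `0`,
tends to `γ > 0` at infinity, and vanishes exactly at `F = 1`. -/
structure IsBrittleEnergy (W : ℝ → ℝ) (γ : ℝ) : Prop where
  contDiffOn : ContDiffOn ℝ 2 W (Ioi 0)
  tendsto_zero : Tendsto W (𝓝[>] 0) atTop
  gamma_pos : 0 < γ
  tendsto_top : Tendsto W atTop (𝓝 γ)
  one : W 1 = 0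
  pos : ∀ F, 0 < F → F ≠ 1 → 0 < W F

/-- `W*(H) = H W(1/H)` for `H > 0`, with the continuous extension `W*(0) = 0`. -/
def Wstar (W : ℝ → ℝ) (H : ℝ) : ℝ := H * W (1 / H)

/-- `S* = dW*/dH` on `[0,∞)` (one-sided at `0`). -/
def Sstar (W : ℝ → ℝ) : ℝ → ℝ := derivWithin (Wstar W) (Ici 0)

/-- `M* = dS*/dH` on `[0,∞)` (one-sided at `0`). -/
def Mstar (W : ℝ → ℝ) : ℝ → ℝ := derivWithin (Sstar W) (Ici 0)

/-! ### The Sobolev space `H²(0,L)`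

Functions are total functions `ℝ → ℝ` of which only the values on `[0,L]` matter. -/

/-- The derivative on `[0,L]` (one-sided at the end points). -/
def D (L : ℝ) (f : ℝ → ℝ) : ℝ → ℝ := derivWithin f (Icc 0 L)

/-- `f ∈ H²(0,L)`, for the `C¹` representative: `f` is differentiable on `[0,L]`, `f'` is absolutely
continuous, and its (almost everywhere defined) derivative `f''` is square integrable. -/
structure MemH2 (L : ℝ) (f : ℝ → ℝ) : Prop where
  differentiableOn : DifferentiableOn ℝ f (Icc 0 L)
  absolutelyContinuous : AbsolutelyContinuousOnInterval (D L f) 0 L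
  memLp : MemLp (D L (D L f)) 2 (volume.restrict (Icc 0 L))

/-- The norm of `H²(0,L)`. -/
def H2norm (L : ℝ) (f : ℝ → ℝ) : ℝ :=
  √(∫ y in (0 : ℝ)..L, (f y ^ 2 + D L f y ^ 2 + D L (D L f) y ^ 2))

/-- `H²(0,L) ∩ H¹₀(0,L)`. -/
def H2H10 (L : ℝ) : Set (ℝ → ℝ) := {ψ | MemH2 L ψ ∧ ψ 0 = 0 ∧ ψ L = 0}

/-! ### Admissible inverse deformations and cracks -/

/-- The admissible set `K`: `h ∈ H²(0,L)`, `h(0) = 0`, `h(L) = 1`, `h' ≥ 0`. -/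
def K (L : ℝ) : Set (ℝ → ℝ) :=
  {h | MemH2 L h ∧ h 0 = 0 ∧ h L = 1 ∧ ∀ y ∈ Icc 0 L, 0 ≤ D L h y}

/-- The total energy `∫₀ᴸ (ε²/2) (h'')² + W*(h')`. -/
def energy (W : ℝ → ℝ) (ε L : ℝ) (h : ℝ → ℝ) : ℝ :=
  ∫ y in (0 : ℝ)..L, (ε ^ 2 / 2 * D L (D L h) y ^ 2 + Wstar W (D L h y))

/-- The broken set `B_h = {y ∈ [0,L] : h'(y) = 0}`. -/
def broken (L : ℝ) (h : ℝ → ℝ) : Set ℝ := {y | y ∈ Icc 0 L ∧ D L h y = 0}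

/-- The good set `G_h = [0,L] \ B_h`. -/
def good (L : ℝ) (h : ℝ → ℝ) : Set ℝ := Icc 0 L \ broken L h

/-- The set `C_h` of crack faces: points of the broken set with no neighbourhood (in `[0,L]`) on
which `h'` vanishes. -/
def crackFaces (L : ℝ) (h : ℝ → ℝ) : Set ℝ :=
  {y | y ∈ broken L h ∧ ¬ ∃ α > 0, Icc (y - α) (y + α) ∩ Icc 0 L ⊆ broken L h}

/-- No crack face is degenerate: each one has a broken interval on one side and an unbroken
interval on the other side. -/
def NondegenerateCracks (L : ℝ) (h : ℝ → ℝ) : Prop :=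
  ∀ y ∈ crackFaces L h, ∃ α > 0,
    (Ico y (y + α) ⊆ broken L h ∧ Ioo (y - α) y ⊆ good L h) ∨
    (Ioc (y - α) y ⊆ broken L h ∧ Ioo y (y + α) ⊆ good L h)

/-- `h` solves the Euler-Lagrange equation: there is a nonnegative Radon measure `μ` carried by the
(compact) broken set with
`∫₀ᴸ ε² h'' ψ'' + S*(h') ψ' = ∫_{B_h} ψ' dμ` for all `ψ ∈ H²(0,L) ∩ H¹₀(0,L)`. -/
def SolvesEL (W : ℝ → ℝ) (ε L : ℝ) (h : ℝ → ℝ) : Prop :=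
  ∃ μ : Measure ℝ, IsFiniteMeasure μ ∧ μ (broken L h)ᶜ = 0 ∧
    ∀ ψ ∈ H2H10 L,
      ∫ y in (0 : ℝ)..L, (ε ^ 2 * D L (D L h) y * D L (D L ψ) y + Sstar W (D L h y) * D L ψ y)
        = ∫ y in broken L h, D L ψ y ∂μ

/-! ### Admissible variations and stability -/

/-- The space `V_h` of admissible variations: `η' ≥ 0` on the broken set (orientation), and `η = 0`
at the crack faces (irreversibility). -/
def admissibleVariations (L : ℝ) (h : ℝ → ℝ) : Set (ℝ → ℝ) :=
  {η | η ∈ H2H10 L ∧ (∀ y ∈ broken L h, 0 ≤ D L η y) ∧ ∀ y ∈ crackFaces L h, η y = 0}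

/-- The space `S_h` of those admissible variations with `η' = 0` and `η = 0` on the broken set. -/
def restrictedVariations (L : ℝ) (h : ℝ → ℝ) : Set (ℝ → ℝ) :=
  {η | η ∈ admissibleVariations L h ∧ (∀ y ∈ broken L h, D L η y = 0) ∧
    ∀ y ∈ broken L h, η y = 0}

/-- The second variation of the energy at `h` in the direction `η`. -/
def secondVariation (W : ℝ → ℝ) (ε L : ℝ) (h η : ℝ → ℝ) : ℝ :=
  ∫ y in (0 : ℝ)..L, (ε ^ 2 * D L (D L η) y ^ 2 + Mstar W (D L h y) * D L η y ^ 2)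

/-- `(r,s)` is an unbroken part of the bar bounded by two crack faces. -/
def IsUnbrokenPart (L : ℝ) (h : ℝ → ℝ) (r s : ℝ) : Prop :=
  r ∈ crackFaces L h ∧ s ∈ crackFaces L h ∧ r < s ∧ Ioo r s ⊆ good L h

/-- The translation mode of the part `(r,s)`: `h'` on `(r,s)` and zero elsewhere. -/
def translationMode (L : ℝ) (h : ℝ → ℝ) (r s : ℝ) : ℝ → ℝ := (Ioo r s).indicator (D L h)

/-- Local stability: `h` minimizes the energy among all `g ∈ K` in an `H²`-ball around `h` that are
reached from `h` by an admissible variation. (A ball of `H²` meets `K` in a convex, relatively open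
set, and every relatively open set around `h` contains such a set.) -/
def LocallyStable (W : ℝ → ℝ) (ε L : ℝ) (h : ℝ → ℝ) : Prop :=
  ∃ δ > 0, ∀ g ∈ K L, g - h ∈ admissibleVariations L h → H2norm L (g - h) < δ →
    energy W ε L h ≤ energy W ε L g

end InverseFracture

end

noncomputable section

namespace InverseFracture

/-! Crack faces are isolated, hence finite in number, and they cut the bar into intervals that are
either broken or unbroken. An admissible `g - h` vanishes at all crack faces, and on the broken
interval next to a crack face its derivative is nonnegative with zero integral, hence zero. So `g'`
vanishes at the crack faces, its cut-off to each interval stays in H¹, and its integral over each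
interval equals that of `h'`. The energy is a sum over intervals. Broken ones are trivial because
`h` has zero energy there and W* ≥ 0, so everything reduces to local minimality on a single unbroken
interval `(a,b)`.

There the argument is by contradiction and compactness. Let `P` be `h'` cut off to `[a,b]`, and
suppose gradients `q` arbitrarily close to `P` have lower energy. The Euler-Lagrange equation tested
with the primitive of `q - P` makes the first variation nonnegative: only the sign of `μ` and `q ≥
0` on the broken set are used (`firstVariation_nonneg`). A second order Taylor bound then makes the
quadratic form with coefficient `M*(P) - o(1)` negative on `q - P` (`energy_comparison`). After
normalization in L² a subsequence converges to a nonzero `p` on which the form is nonpositive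
(`exists_limit_of_form_neg`), and the primitive of `p` is a restricted variation violating
positivity (`false_of_form_nonpos`).

If both ends are crack faces, the limit must also be orthogonal to the translation mode. Translating
the cut-off `g'` slightly into the broken margins changes neither its energy nor its integral, and
although the translate no longer comes from an admissible variation, the sign argument above still
covers it. An intermediate value argument finds a translate with the required orthogonality
(`exists_shift_orthogonal`).

That the translation modes lie in H² is a difference quotient argument: translates of `P` have the
same energy as `P`, so the same comparison bounds the difference quotients of `P'` in L²
(`exists_memH1_derivative`). -/

/-- `q` is a primitive on `[0,L]` of the square integrable function `z`, i.e. `q ∈ H¹(0,L)` with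
weak derivative `z`. -/
structure MemH1 (L : ℝ) (q z : ℝ → ℝ) : Prop where
  memLp : MemLp z 2 (volume.restrict (Icc 0 L))
  eq_add_integral : ∀ y ∈ Icc 0 L, q y = q 0 + ∫ t in (0 : ℝ)..y, z t

/-! ### Square integrable functions and H¹ functions as primitives -/

lemma intervalIntegrable_of_restrict {L : ℝ} (hL : 0 ≤ L) {f : ℝ → ℝ}
    (hf : Integrable f (volume.restrict (Icc 0 L))) : IntervalIntegrable f volume 0 L := by
  rw [intervalIntegrable_iff_integrableOn_Icc_of_le hL]; exact hf

lemma intervalIntegral_eq_restrict {L : ℝ} (hL : 0 ≤ L) (f : ℝ → ℝ) :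
    ∫ y in (0 : ℝ)..L, f y = ∫ y, f y ∂(volume.restrict (Icc 0 L)) := by
  rw [intervalIntegral.integral_of_le hL, integral_Icc_eq_integral_Ioc]

lemma MemLp.intervalIntegrable_mul {L : ℝ} (hL : 0 ≤ L) {f g : ℝ → ℝ}
    (hf : MemLp f 2 (volume.restrict (Icc 0 L))) (hg : MemLp g 2 (volume.restrict (Icc 0 L))) :
    IntervalIntegrable (fun y => f y * g y) volume 0 L :=
  intervalIntegrable_of_restrict hL (hf.integrable_mul hg)

lemma MemLp.intervalIntegrable_sq {L : ℝ} (hL : 0 ≤ L) {f : ℝ → ℝ}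
    (hf : MemLp f 2 (volume.restrict (Icc 0 L))) :
    IntervalIntegrable (fun y => f y ^ 2) volume 0 L :=
  intervalIntegrable_of_restrict hL hf.integrable_sq

lemma MemLp.intervalIntegrable_self {L : ℝ} (hL : 0 ≤ L) {f : ℝ → ℝ}
    (hf : MemLp f 2 (volume.restrict (Icc 0 L))) : IntervalIntegrable f volume 0 L :=
  intervalIntegrable_of_restrict hL (hf.integrable (by norm_num))

/-- The Cauchy-Schwarz inequality `(∫ f)² ≤ (b - a) ∫ f²`. -/
lemma sq_integral_le {a b : ℝ} (hab : a ≤ b) {f : ℝ → ℝ} (hf : IntervalIntegrable f volume a b)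
    (hf2 : IntervalIntegrable (fun y => f y ^ 2) volume a b) :
    (∫ y in a..b, f y) ^ 2 ≤ (b - a) * ∫ y in a..b, f y ^ 2 := by
  rcases hab.eq_or_lt with rfl | hlt
  · simp
  set A := ∫ y in a..b, f y with hA
  have hl : 0 < b - a := sub_pos.2 hlt
  -- The variance of `f` about its mean is nonnegative; expanding the square gives the inequality.
  have h0 : 0 ≤ ∫ y in a..b, (f y - A / (b - a)) ^ 2 :=
    intervalIntegral.integral_nonneg hab fun _ _ => sq_nonneg _
  have h1 : ∫ y in a..b, (f y - A / (b - a)) ^ 2 =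
      (∫ y in a..b, f y ^ 2) - 2 * (A / (b - a)) * A + (b - a) * (A / (b - a)) ^ 2 := by
    have : ∀ y, (f y - A / (b - a)) ^ 2 =
        f y ^ 2 - 2 * (A / (b - a)) * f y + (A / (b - a)) ^ 2 := fun y => by ring
    simp_rw [this]
    rw [intervalIntegral.integral_add (hf2.sub (hf.const_mul _)) intervalIntegrable_const,
      intervalIntegral.integral_sub hf2 (hf.const_mul _), intervalIntegral.integral_const_mul,
      intervalIntegral.integral_const, smul_eq_mul]
  rw [h1] at h0
  have h2 : (b - a) * ((∫ y in a..b, f y ^ 2) - 2 * (A / (b - a)) * A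
      + (b - a) * (A / (b - a)) ^ 2) = (b - a) * (∫ y in a..b, f y ^ 2) - A ^ 2 := by
    field_simp; ring
  nlinarith [mul_nonneg hl.le h0]

namespace MemH1

variable {L : ℝ} {q z q' z' : ℝ → ℝ}

lemma continuousOn (hL : 0 ≤ L) (hq : MemH1 L q z) : ContinuousOn q (Icc 0 L) := by
  have hi := MemLp.intervalIntegrable_self hL hq.memLp
  have := intervalIntegral.continuousOn_primitive_interval' hi (left_mem_uIcc)
  rw [uIcc_of_le hL] at this
  exact (continuousOn_const.add this).congr hq.eq_add_integral

lemma sub (hL : 0 ≤ L) (hq : MemH1 L q z) (hq' : MemH1 L q' z') :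
    MemH1 L (fun y => q y - q' y) (fun y => z y - z' y) := by
  refine ⟨hq.memLp.sub hq'.memLp, fun y hy => ?_⟩
  have hi := (MemLp.intervalIntegrable_self hL hq.memLp).mono_set
    (uIcc_subset_uIcc left_mem_uIcc (by rwa [uIcc_of_le hL]))
  have hi' := (MemLp.intervalIntegrable_self hL hq'.memLp).mono_set
    (uIcc_subset_uIcc left_mem_uIcc (by rwa [uIcc_of_le hL]))
  rw [intervalIntegral.integral_sub hi hi', hq.eq_add_integral y hy, hq'.eq_add_integral y hy]
  ring

lemma const_mul (c : ℝ) (hq : MemH1 L q z) :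
    MemH1 L (fun y => c * q y) (fun y => c * z y) := by
  refine ⟨hq.memLp.const_mul c, fun y hy => ?_⟩
  rw [intervalIntegral.integral_const_mul, hq.eq_add_integral y hy]
  ring

lemma sub_eq_integral (hL : 0 ≤ L) (hq : MemH1 L q z) {x y : ℝ} (hx : x ∈ Icc 0 L)
    (hy : y ∈ Icc 0 L) : q y - q x = ∫ t in x..y, z t := by
  have hi := MemLp.intervalIntegrable_self hL hq.memLp
  have := intervalIntegral.integral_interval_sub_left (a := 0) (b := y) (c := x)
    (hi.mono_set (uIcc_subset_uIcc left_mem_uIcc (by rwa [uIcc_of_le hL])))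
    (hi.mono_set (uIcc_subset_uIcc left_mem_uIcc (by rwa [uIcc_of_le hL])))
  rw [hq.eq_add_integral y hy, hq.eq_add_integral x hx, ← this]
  ring

lemma sq_sub_le (hL : 0 ≤ L) (hq : MemH1 L q z) {x y : ℝ} (hx : x ∈ Icc 0 L)
    (hy : y ∈ Icc 0 L) : (q y - q x) ^ 2 ≤ L * ∫ t in (0 : ℝ)..L, z t ^ 2 := by
  wlog hxy : x ≤ y generalizing x y
  · have := this hy hx (le_of_not_ge hxy)
    rwa [← neg_sub, neg_sq]
  have hi := MemLp.intervalIntegrable_self hL hq.memLp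
  have hi2 := MemLp.intervalIntegrable_sq hL hq.memLp
  have hs : uIcc x y ⊆ uIcc 0 L := by
    rw [uIcc_of_le hL, uIcc_of_le hxy]; exact Icc_subset_Icc hx.1 hy.2
  rw [hq.sub_eq_integral hL hx hy]
  refine (sq_integral_le hxy (hi.mono_set hs) (hi2.mono_set hs)).trans ?_
  have h1 : ∫ t in x..y, z t ^ 2 ≤ ∫ t in (0 : ℝ)..L, z t ^ 2 :=
    intervalIntegral.integral_mono_interval hx.1 hxy hy.2
      (Eventually.of_forall fun _ => sq_nonneg _) hi2
  have h0 : 0 ≤ ∫ t in x..y, z t ^ 2 := intervalIntegral.integral_nonneg hxy fun _ _ => sq_nonneg _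
  exact mul_le_mul (by linarith [hx.1, hy.2]) h1 h0 hL

lemma intervalIntegrable_sq_left (hL : 0 ≤ L) (hq : MemH1 L q z) :
    IntervalIntegrable (fun y => q y ^ 2) volume 0 L := by
  apply ContinuousOn.intervalIntegrable
  rw [uIcc_of_le hL]; exact (hq.continuousOn hL).pow 2

/-- The Sobolev embedding `H¹(0,L) ⊆ C([0,L])`, with an explicit constant. -/
lemma sq_le (hL : 0 ≤ L) (hq : MemH1 L q z) {y : ℝ} (hy : y ∈ Icc 0 L) :
    L * q y ^ 2 ≤ 2 * (∫ t in (0 : ℝ)..L, q t ^ 2) + 2 * L ^ 2 * ∫ t in (0 : ℝ)..L, z t ^ 2 := by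
  set A := ∫ t in (0 : ℝ)..L, z t ^ 2
  have h1 : ∫ _ in (0 : ℝ)..L, q y ^ 2 ≤ ∫ t in (0 : ℝ)..L, (2 * q t ^ 2 + 2 * (L * A)) := by
    apply intervalIntegral.integral_mono_on hL intervalIntegrable_const
      (((hq.intervalIntegrable_sq_left hL).const_mul _).add intervalIntegrable_const)
    intro t ht
    -- Here `q(y)² ≤ 2 q(t)² + 2 (q(y) - q(t))²`, the gap being exactly `(q(y) - 2 q(t))²`.
    nlinarith [hq.sq_sub_le hL ht hy, sq_nonneg (q y - 2 * q t)]
  rw [intervalIntegral.integral_add ((hq.intervalIntegrable_sq_left hL).const_mul _)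
    intervalIntegrable_const, intervalIntegral.integral_const_mul] at h1
  simp only [intervalIntegral.integral_const, smul_eq_mul, sub_zero] at h1
  nlinarith

end MemH1

/-! ### Passage between H² functions and H¹ gradients -/

lemma MemH2.memH1 {L : ℝ} (hL : 0 < L) {f : ℝ → ℝ} (hf : MemH2 L f) :
    MemH1 L (D L f) (D L (D L f)) := by
  refine ⟨hf.memLp, fun y hy => ?_⟩
  have hac : AbsolutelyContinuousOnInterval (D L f) 0 y :=
    hf.absolutelyContinuous.mono
      (uIcc_subset_uIcc left_mem_uIcc (by rwa [uIcc_of_le hL.le]))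
  -- The one-sided and two-sided derivatives can differ only at the end points of `[0,L]`, a null
  -- set; then the fundamental theorem for absolutely continuous functions applies.
  have h1 : ∫ t in (0 : ℝ)..y, D L (D L f) t = ∫ t in (0 : ℝ)..y, deriv (D L f) t := by
    apply intervalIntegral.integral_congr_ae
    have : ∀ᵐ t : ℝ, t ≠ y := by simp [ae_iff]
    filter_upwards [this] with t hty ht
    rw [uIoc_of_le hy.1] at ht
    exact derivWithin_of_mem_nhds (Icc_mem_nhds ht.1 ((lt_of_le_of_ne ht.2 hty).trans_le hy.2))
  rw [h1, hac.integral_deriv_eq_sub]; ring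

lemma MemH2.hasDerivWithinAt {L : ℝ} {f : ℝ → ℝ} (hf : MemH2 L f) {y : ℝ} (hy : y ∈ Icc 0 L) :
    HasDerivWithinAt f (D L f y) (Icc 0 L) y :=
  (hf.differentiableOn y hy).hasDerivWithinAt

lemma MemH2.continuousOn_D {L : ℝ} (hL : 0 < L) {f : ℝ → ℝ} (hf : MemH2 L f) :
    ContinuousOn (D L f) (Icc 0 L) := (hf.memH1 hL).continuousOn hL.le

lemma MemH2.sub_eq_integral {L : ℝ} (hL : 0 < L) {f : ℝ → ℝ} (hf : MemH2 L f) {x y : ℝ}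
    (hx : x ∈ Icc 0 L) (hy : y ∈ Icc 0 L) : f y - f x = ∫ t in x..y, D L f t := by
  have hs : uIcc x y ⊆ Icc 0 L := by
    rw [← uIcc_of_le hL.le]
    exact uIcc_subset_uIcc (by rwa [uIcc_of_le hL.le]) (by rwa [uIcc_of_le hL.le])
  symm
  apply intervalIntegral.integral_eq_sub_of_hasDeriv_right
    (hf.differentiableOn.continuousOn.mono hs)
  · intro t ht
    have ht' : t ∈ Ioo 0 L := by
      have hmin : 0 ≤ min x y := le_min hx.1 hy.1
      have hmax : max x y ≤ L := max_le hx.2 hy.2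
      exact ⟨hmin.trans_lt ht.1, ht.2.trans_le hmax⟩
    exact ((hf.hasDerivWithinAt ⟨ht'.1.le, ht'.2.le⟩).hasDerivAt
      (Icc_mem_nhds ht'.1 ht'.2)).hasDerivWithinAt
  · exact ((hf.continuousOn_D hL).mono hs).intervalIntegrable

section primitive

variable {L : ℝ} {q z : ℝ → ℝ}

lemma hasDerivWithinAt_primitive (hL : 0 < L) (hq : ContinuousOn q (Icc 0 L)) {y : ℝ}
    (hy : y ∈ Icc 0 L) :
    HasDerivWithinAt (fun x => ∫ t in (0 : ℝ)..x, q t) (q y) (Icc 0 L) y := by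
  have : Fact (y ∈ Icc (0 : ℝ) L) := ⟨hy⟩
  have hq' : ContinuousOn q (uIcc 0 L) := by rwa [uIcc_of_le hL.le]
  apply intervalIntegral.integral_hasDerivWithinAt_right
    (hq'.intervalIntegrable.mono_set (uIcc_subset_uIcc left_mem_uIcc (by rwa [uIcc_of_le hL.le])))
    (t := Icc 0 L)
  · exact ⟨Icc 0 L, self_mem_nhdsWithin, hq.aestronglyMeasurable measurableSet_Icc⟩
  · exact hq y hy

lemma D_primitive (hL : 0 < L) (hq : ContinuousOn q (Icc 0 L)) {y : ℝ} (hy : y ∈ Icc 0 L) :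
    D L (fun x => ∫ t in (0 : ℝ)..x, q t) y = q y :=
  (hasDerivWithinAt_primitive hL hq hy).derivWithin (uniqueDiffOn_Icc hL y hy)

lemma D_congr {f g : ℝ → ℝ} (hfg : EqOn f g (Icc 0 L)) : EqOn (D L f) (D L g) (Icc 0 L) :=
  fun _ hy => derivWithin_congr hfg (hfg hy)

lemma MemH1.D_ae_eq (hL : 0 < L) (hq : MemH1 L q z) :
    D L q =ᵐ[volume.restrict (Icc 0 L)] z := by
  have hi := MemLp.intervalIntegrable_self hL.le hq.memLp
  have h0 : ∀ᵐ y : ℝ, y ≠ 0 := by simp [ae_iff]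
  have h1 : ∀ᵐ y : ℝ, y ≠ L := by simp [ae_iff]
  rw [EventuallyEq, ae_restrict_iff' measurableSet_Icc]
  filter_upwards [hi.ae_hasDerivAt_integral, h0, h1] with y hy hy0 hy1 hyL
  have hd := hy (by rwa [uIcc_of_le hL.le]) 0 (by simp)
  rw [D_congr hq.eq_add_integral hyL]
  exact ((hd.const_add (q 0)).hasDerivWithinAt).derivWithin (uniqueDiffOn_Icc hL y hyL)

lemma MemH1.absolutelyContinuous (hL : 0 < L) (hq : MemH1 L q z) :
    AbsolutelyContinuousOnInterval q 0 L := by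
  have hi := MemLp.intervalIntegrable_self hL.le hq.memLp
  have h1 := hi.absolutelyContinuousOnInterval_intervalIntegral (c := 0) (by simp)
  have h2 : AbsolutelyContinuousOnInterval (fun _ : ℝ => q 0) 0 L :=
    ((LipschitzWith.const (q 0)).lipschitzOnWith).absolutelyContinuousOnInterval
  have h3 := h2.fun_add h1
  rw [absolutelyContinuousOnInterval_iff] at h3 ⊢
  intro e he
  obtain ⟨d, hd, H⟩ := h3 e he
  refine ⟨d, hd, fun E hE hlt => ?_⟩
  refine lt_of_eq_of_lt (Finset.sum_congr rfl fun i hi => ?_) (H E hE hlt)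
  have := hE.1 i (by simpa using hi)
  rw [uIcc_of_le hL.le] at this
  rw [← hq.eq_add_integral _ this.1, ← hq.eq_add_integral _ this.2]

/-- Competitors, limits and difference quotients are all constructed as gradients given by
integrals; this turns such a gradient back into membership in H². -/
lemma memH2_of_D (hL : 0 < L) {f : ℝ → ℝ} (hq : MemH1 L q z)
    (hf : ∀ y ∈ Icc 0 L, HasDerivWithinAt f (q y) (Icc 0 L) y) : MemH2 L f := by
  have hD : EqOn (D L f) q (Icc 0 L) := fun y hy => (hf y hy).derivWithin (uniqueDiffOn_Icc hL y hy)
  have h1 : MemH1 L (D L f) z := by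
    refine ⟨hq.memLp, fun y hy => ?_⟩
    rw [hD hy, hD ⟨le_rfl, hL.le⟩, hq.eq_add_integral y hy]
  exact ⟨fun y hy => (hf y hy).differentiableWithinAt, h1.absolutelyContinuous hL,
    hq.memLp.ae_eq (h1.D_ae_eq hL).symm⟩

lemma memH2_primitive (hL : 0 < L) (hq : MemH1 L q z) :
    MemH2 L (fun x => ∫ t in (0 : ℝ)..x, q t) :=
  memH2_of_D hL hq fun _ hy => hasDerivWithinAt_primitive hL (hq.continuousOn hL.le) hy

lemma D_D_primitive (hL : 0 < L) (hq : MemH1 L q z) :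
    D L (D L (fun x => ∫ t in (0 : ℝ)..x, q t)) =ᵐ[volume.restrict (Icc 0 L)] z := by
  have hD : EqOn (D L (fun x => ∫ t in (0 : ℝ)..x, q t)) q (Icc 0 L) :=
    fun y hy => D_primitive hL (hq.continuousOn hL.le) hy
  refine EventuallyEq.trans ?_ (hq.D_ae_eq hL)
  filter_upwards [ae_restrict_mem measurableSet_Icc] with y hy
  exact D_congr hD hy

end primitive

/-! ### Weak compactness in H¹ -/

/-- Sequential compactness of bounded subsets of `H¹(0,L)`: pointwise convergence of functions,
lower semicontinuity of the Dirichlet integral. -/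
lemma exists_subseq_memH1 {L C : ℝ} (hL : 0 ≤ L) {q z : ℕ → ℝ → ℝ} (hq : ∀ n, MemH1 L (q n) (z n))
    (h0 : ∀ n, |q n 0| ≤ C) (hz : ∀ n, ∫ t in (0 : ℝ)..L, z n t ^ 2 ≤ C) :
    ∃ σ : ℕ → ℕ, StrictMono σ ∧ ∃ p w : ℝ → ℝ, MemH1 L p w ∧
      (∀ y ∈ Icc 0 L, Tendsto (fun n => q (σ n) y) atTop (𝓝 (p y))) ∧
      ∀ (A : ℕ → ℝ) (a : ℝ), Tendsto A atTop (𝓝 a) →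
        (∀ n, ∫ t in (0 : ℝ)..L, z (σ n) t ^ 2 ≤ A n) → ∫ t in (0 : ℝ)..L, w t ^ 2 ≤ a := by
  set μ : Measure ℝ := volume.restrict (Icc 0 L) with hμ
  have : Fact ((2 : ENNReal) ≠ ⊤) := ⟨by norm_num⟩
  set U : ℕ → Lp ℝ 2 μ := fun n => (hq n).memLp.toLp (z n) with hU
  have hinner : ∀ n (v : Lp ℝ 2 μ), inner ℝ (U n) v = ∫ y in (0 : ℝ)..L, z n y * v y := by
    intro n v
    rw [L2.inner_def, intervalIntegral_eq_restrict hL]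
    apply integral_congr_ae
    filter_upwards [(hq n).memLp.coeFn_toLp] with y hy
    rw [hU]; simp [hy, mul_comm]
  have hnorm : ∀ n, ‖U n‖ ^ 2 = ∫ y in (0 : ℝ)..L, z n y ^ 2 := by
    intro n
    rw [← real_inner_self_eq_norm_sq, hinner, intervalIntegral_eq_restrict hL,
      intervalIntegral_eq_restrict hL]
    apply integral_congr_ae
    filter_upwards [(hq n).memLp.coeFn_toLp] with y hy
    rw [hU]; simp only [hy]; ring
  obtain ⟨c, hc, σ₁, hσ₁, hc1⟩ := (isCompact_Icc (a := -C) (b := C)).tendsto_subseq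
    (x := fun n => q n 0) (fun n => abs_le.1 (h0 n))
  have hball : ∀ n, StrongDual.toWeakDual (InnerProductSpace.toDual ℝ (Lp ℝ 2 μ) (U (σ₁ n))) ∈
      (WeakDual.toStrongDual ⁻¹' Metric.closedBall (0 : StrongDual ℝ (Lp ℝ 2 μ)) (√C)) := by
    intro n
    simp only [mem_preimage, mem_closedBall_zero_iff]
    have : ‖InnerProductSpace.toDual ℝ (Lp ℝ 2 μ) (U (σ₁ n))‖ ≤ √C := by
      rw [LinearIsometryEquiv.norm_map]
      exact Real.le_sqrt_of_sq_le (by rw [hnorm]; exact hz _)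
    exact this
  -- Sequential Banach-Alaoglu in the dual of L², carried back to L² by the Riesz isomorphism, gives
  -- a weak limit of the derivatives.
  obtain ⟨ℓ, -, σ₂, hσ₂, hℓ⟩ := WeakDual.isSeqCompact_closedBall ℝ (Lp ℝ 2 μ) 0 (√C) hball
  set w : Lp ℝ 2 μ := (InnerProductSpace.toDual ℝ (Lp ℝ 2 μ)).symm (WeakDual.toStrongDual ℓ) with hw
  have hweak : ∀ v : Lp ℝ 2 μ,
      Tendsto (fun n => inner ℝ (U (σ₁ (σ₂ n))) v) atTop (𝓝 (inner ℝ w v)) := by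
    intro v
    have h1 := ((WeakDual.eval_continuous v).tendsto ℓ).comp hℓ
    have h2 : inner ℝ w v = ℓ v := by
      rw [hw, InnerProductSpace.toDual_symm_apply]; rfl
    rw [h2]
    exact h1
  have hwL : MemLp w 2 μ := Lp.memLp w
  refine ⟨σ₁ ∘ σ₂, hσ₁.comp hσ₂, fun y => c + ∫ t in (0 : ℝ)..y, w t, w, ⟨hwL, ?_⟩, ?_, ?_⟩
  · intro y hy; simp
  · intro y hy
    -- Pairing the weak convergence with the indicator of `[0,y]` gives convergence of the
    -- primitives at `y`.
    have hind : MemLp ((Icc 0 y).indicator (fun _ => (1 : ℝ))) 2 μ :=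
      (memLp_const 1).indicator measurableSet_Icc
    have key : ∀ f : ℝ → ℝ, ∫ t in (0 : ℝ)..L, f t * hind.toLp _ t = ∫ t in (0 : ℝ)..y, f t := by
      intro f
      rw [intervalIntegral_eq_restrict hL, intervalIntegral_eq_restrict hy.1]
      have : ∫ t, f t * hind.toLp _ t ∂μ = ∫ t, (Icc 0 y).indicator f t ∂μ := by
        apply integral_congr_ae
        filter_upwards [hind.coeFn_toLp] with t ht
        rw [ht]
        by_cases hty : t ∈ Icc 0 y <;> simp [hty]
      rw [this, integral_indicator measurableSet_Icc, hμ, Measure.restrict_restrict measurableSet_Icc,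
        inter_eq_self_of_subset_left (Icc_subset_Icc_right hy.2)]
    have h1 := hweak (hind.toLp _)
    have h2 : inner ℝ w (hind.toLp _) = ∫ t in (0 : ℝ)..y, w t := by
      rw [← key, L2.inner_def, intervalIntegral_eq_restrict hL]
      apply integral_congr_ae
      filter_upwards with t
      simp [mul_comm]
    rw [h2] at h1
    simp_rw [hinner, key] at h1
    have h3 := (hc1.comp hσ₂.tendsto_atTop).add h1
    refine h3.congr fun n => ?_
    simp only [Function.comp]
    exact ((hq _).eq_add_integral y hy).symm
  · intro A a hA hle
    have hww : ∫ t in (0 : ℝ)..L, w t ^ 2 = inner ℝ w w := by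
      rw [L2.inner_def, intervalIntegral_eq_restrict hL]
      apply integral_congr_ae
      filter_upwards with t
      simp [sq]
    rw [hww]
    -- Lower semicontinuity: `2⟨U,w⟩ - ‖w‖² ≤ ‖U‖²`, and the left side converges to `‖w‖²` along the
    -- subsequence.
    have h1 := ((hweak w).const_mul 2).sub_const (inner ℝ w w)
    have h2 : inner ℝ w w = 2 * inner ℝ w w - inner ℝ w w := by ring
    rw [h2]
    refine le_of_tendsto_of_tendsto' h1 hA fun n => le_trans ?_ (hle n)
    simp only [Function.comp]
    rw [← hnorm]
    have h3 := norm_sub_sq_real (U (σ₁ (σ₂ n))) w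
    rw [real_inner_self_eq_norm_sq]
    nlinarith [sq_nonneg ‖U (σ₁ (σ₂ n)) - w‖]

/-! ### Second order expansion of the stored energy -/

section energyDensity

variable {W : ℝ → ℝ}

lemma contDiffOn_Sstar (hW : ContDiffOn ℝ 2 (Wstar W) (Ici 0)) :
    ContDiffOn ℝ 1 (Sstar W) (Ici 0) :=
  hW.derivWithin (uniqueDiffOn_Ici 0) (by norm_num)

lemma continuousOn_Mstar (hW : ContDiffOn ℝ 2 (Wstar W) (Ici 0)) :
    ContinuousOn (Mstar W) (Ici 0) :=
  (contDiffOn_Sstar hW).continuousOn_derivWithin (uniqueDiffOn_Ici 0) le_rfl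

lemma hasDerivAt_Wstar (hW : ContDiffOn ℝ 2 (Wstar W) (Ici 0)) {t : ℝ} (ht : 0 < t) :
    HasDerivAt (Wstar W) (Sstar W t) t :=
  ((hW.differentiableOn (by norm_num) t ht.le).hasDerivWithinAt).hasDerivAt (Ici_mem_nhds ht)

lemma hasDerivAt_Sstar (hW : ContDiffOn ℝ 2 (Wstar W) (Ici 0)) {t : ℝ} (ht : 0 < t) :
    HasDerivAt (Sstar W) (Mstar W t) t :=
  (((contDiffOn_Sstar hW).differentiableOn (by norm_num) t ht.le).hasDerivWithinAt).hasDerivAt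
    (Ici_mem_nhds ht)

lemma Wstar_zero : Wstar W 0 = 0 := by simp [Wstar]

lemma Wstar_nonneg {γ : ℝ} (hW : IsBrittleEnergy W γ) {t : ℝ} (ht : 0 ≤ t) : 0 ≤ Wstar W t := by
  rcases ht.eq_or_lt with rfl | ht
  · rw [Wstar_zero]
  · refine mul_nonneg ht.le ?_
    by_cases h1 : 1 / t = 1
    · rw [h1, hW.one]
    · exact (hW.pos _ (by positivity) h1).le

/-- Second order Taylor estimate from below. -/
lemma Wstar_taylor_le (hW : ContDiffOn ℝ 2 (Wstar W) (Ici 0)) {x y m : ℝ} (hx : 0 ≤ x) (hy : 0 ≤ y)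
    (hm : ∀ t ∈ uIcc x y, m ≤ Mstar W t) :
    m / 2 * (y - x) ^ 2 ≤ Wstar W y - Wstar W x - Sstar W x * (y - x) := by
  have hWc := hW.continuousOn
  have hSc := (contDiffOn_Sstar hW).continuousOn
  -- Up to constants `F` is the Taylor remainder of W* minus the quadratic, so `F'(x) = G(x) = 0`
  -- and `F'' = M* - m ≥ 0` between `x` and `y`. Two applications of the mean value theorem, which
  -- need derivatives only at interior points and hence only at `t > 0`, give `F x ≤ F y`.
  set F : ℝ → ℝ := fun t => Wstar W t - Sstar W x * (t - x) - m / 2 * (t - x) ^ 2 with hF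
  set G : ℝ → ℝ := fun t => Sstar W t - Sstar W x - m * (t - x) with hG
  have hFc : ContinuousOn F (Ici 0) := by fun_prop
  have hGc : ContinuousOn G (Ici 0) := by fun_prop
  have hFd : ∀ t, 0 < t → HasDerivAt F (G t) t := by
    intro t ht
    have h1 : HasDerivAt (fun t => t - x) 1 t := (hasDerivAt_id t).sub_const x
    have h2 := ((hasDerivAt_Wstar hW ht).sub (h1.const_mul (Sstar W x))).sub
      ((h1.pow 2).const_mul (m / 2))
    refine h2.congr_deriv ?_
    simp only [hG]; push_cast; ring
  have hGd : ∀ t, 0 < t → HasDerivAt G (Mstar W t - m) t := by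
    intro t ht
    have h1 : HasDerivAt (fun t => t - x) 1 t := (hasDerivAt_id t).sub_const x
    have h2 := ((hasDerivAt_Sstar hW ht).sub_const (Sstar W x)).sub (h1.const_mul m)
    refine h2.congr_deriv ?_
    ring
  have hGx : G x = 0 := by simp [hG]
  have hFx : F x = Wstar W x := by simp [hF]
  suffices F x ≤ F y by
    rw [hFx] at this; simp only [hF] at this; linarith
  rcases lt_trichotomy x y with hxy | rfl | hxy
  · have hsub : Icc x y ⊆ Ici 0 := fun t ht => hx.trans ht.1
    have hGn : ∀ t ∈ Ioo x y, 0 ≤ G t := by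
      intro t ht
      obtain ⟨c, hc, hc'⟩ := exists_hasDerivAt_eq_slope G (fun t => Mstar W t - m) ht.1
        (hGc.mono fun s hs => hx.trans hs.1) fun s hs => hGd s (hx.trans_lt hs.1)
      have h1 := hm c (by rw [uIcc_of_le hxy.le]; exact ⟨hc.1.le, (hc.2.trans ht.2).le⟩)
      rw [hGx, sub_zero, eq_div_iff (sub_pos.2 ht.1).ne'] at hc'
      rw [← hc']
      exact mul_nonneg (sub_nonneg.2 h1) (sub_pos.2 ht.1).le
    obtain ⟨c, hc, hc'⟩ := exists_hasDerivAt_eq_slope F G hxy (hFc.mono hsub)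
      fun s hs => hFd s (hx.trans_lt hs.1)
    rw [eq_div_iff (sub_pos.2 hxy).ne'] at hc'
    nlinarith [mul_nonneg (hGn c hc) (sub_pos.2 hxy).le]
  · exact le_rfl
  · have hsub : Icc y x ⊆ Ici 0 := fun t ht => hy.trans ht.1
    have hGn : ∀ t ∈ Ioo y x, G t ≤ 0 := by
      intro t ht
      obtain ⟨c, hc, hc'⟩ := exists_hasDerivAt_eq_slope G (fun t => Mstar W t - m) ht.2
        (hGc.mono fun s hs => hy.trans (ht.1.le.trans hs.1))
        fun s hs => hGd s (hy.trans_lt (ht.1.trans hs.1))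
      have h1 := hm c (by rw [uIcc_of_ge hxy.le]; exact ⟨(ht.1.trans hc.1).le, hc.2.le⟩)
      rw [hGx, zero_sub, eq_div_iff (sub_pos.2 ht.2).ne'] at hc'
      nlinarith [mul_nonneg (sub_nonneg.2 h1) (sub_pos.2 ht.2).le]
    obtain ⟨c, hc, hc'⟩ := exists_hasDerivAt_eq_slope F G hxy (hFc.mono hsub)
      fun s hs => hFd s (hy.trans_lt hs.1)
    rw [eq_div_iff (sub_pos.2 hxy).ne'] at hc'
    nlinarith [mul_nonneg (neg_nonneg.2 (hGn c hc)) (sub_pos.2 hxy).le]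

end energyDensity

/-! ### Comparison of energies through the Euler-Lagrange equation -/

/-- The energy density of a deformation gradient `q` with derivative `z`. -/
def density (W : ℝ → ℝ) (ε : ℝ) (q z : ℝ → ℝ) (y : ℝ) : ℝ := ε ^ 2 / 2 * z y ^ 2 + Wstar W (q y)

/-- The gradient `h'` cut off to `[a,b]`. -/
def cutGrad (L : ℝ) (h : ℝ → ℝ) (a b : ℝ) : ℝ → ℝ := (Icc a b).indicator (D L h)

/-- The second derivative `h''` cut off to `[a,b]`. -/
def cutHess (L : ℝ) (h : ℝ → ℝ) (a b : ℝ) : ℝ → ℝ := (Icc a b).indicator (D L (D L h))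

section comparison

variable {W : ℝ → ℝ} {ε L : ℝ} {h : ℝ → ℝ}

lemma broken_isClosed (hL : 0 < L) (hK : h ∈ K L) : IsClosed (broken L h) :=
  (hK.1.continuousOn_D hL).preimage_isClosed_of_isClosed isClosed_Icc isClosed_singleton

lemma cutGrad_nonneg (hK : h ∈ K L) (a b : ℝ) {y : ℝ} (hy : y ∈ Icc 0 L) :
    0 ≤ cutGrad L h a b y := by
  unfold cutGrad
  by_cases hab : y ∈ Icc a b
  · rw [indicator_of_mem hab]; exact hK.2.2.2 y hy
  · rw [indicator_of_notMem hab]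

lemma cutGrad_broken {a b y : ℝ} (hy : y ∈ broken L h) : cutGrad L h a b y = 0 := by
  unfold cutGrad
  by_cases hab : y ∈ Icc a b
  · rw [indicator_of_mem hab]; exact hy.2
  · rw [indicator_of_notMem hab]

/-- Testing the Euler-Lagrange equation with the difference of a competitor supported near `[a,b]`
and `h'` cut off to `[a,b]`. -/
lemma firstVariation_nonneg (hL : 0 < L) (hK : h ∈ K L) (hEL : SolvesEL W ε L h)
    (hB : ∀ᵐ y ∂(volume.restrict (Icc 0 L)), y ∈ broken L h → D L (D L h) y = 0) {a b : ℝ}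
    (hP : MemH1 L (cutGrad L h a b) (cutHess L h a b)) {q z : ℝ → ℝ} (hq : MemH1 L q z)
    (hq0 : ∀ y ∈ Icc 0 L, 0 ≤ q y)
    (hint : ∫ y in (0 : ℝ)..L, q y = ∫ y in (0 : ℝ)..L, cutGrad L h a b y)
    (hoff : ∀ y ∈ Icc 0 L, y ∉ Icc a b → y ∈ broken L h ∨ (q y = 0 ∧ z y = 0)) :
    0 ≤ ∫ y in (0 : ℝ)..L, (ε ^ 2 * cutHess L h a b y * (z y - cutHess L h a b y) +
      Sstar W (cutGrad L h a b y) * (q y - cutGrad L h a b y)) := by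
  obtain ⟨μ, -, -, hμ⟩ := hEL
  have hφ := hq.sub hL.le hP
  have hφc := hφ.continuousOn hL.le
  have hqi : IntervalIntegrable q volume 0 L := by
    apply ContinuousOn.intervalIntegrable; rw [uIcc_of_le hL.le]; exact hq.continuousOn hL.le
  have hPi : IntervalIntegrable (cutGrad L h a b) volume 0 L := by
    apply ContinuousOn.intervalIntegrable; rw [uIcc_of_le hL.le]; exact hP.continuousOn hL.le
  -- The primitive of `q - h'·1_[a,b]` vanishes at `L` because the two integrals agree, so it is an
  -- allowed test function.
  have key := hμ (fun x => ∫ t in (0 : ℝ)..x, (q t - cutGrad L h a b t))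
    ⟨memH2_primitive hL hφ, by simp, by
      beta_reduce
      rw [intervalIntegral.integral_sub hqi hPi, hint, sub_self]⟩
  have hnn : 0 ≤ ∫ y in broken L h, D L (fun x => ∫ t in (0 : ℝ)..x, (q t - cutGrad L h a b t)) y ∂μ := by
    apply setIntegral_nonneg (broken_isClosed hL hK).measurableSet
    intro y hy
    rw [D_primitive hL hφc hy.1, cutGrad_broken hy, sub_zero]
    exact hq0 y hy.1
  rw [← key] at hnn
  refine hnn.trans_eq ?_
  rw [intervalIntegral_eq_restrict hL.le, intervalIntegral_eq_restrict hL.le]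
  apply integral_congr_ae
  filter_upwards [hB, D_D_primitive hL hφ, ae_restrict_mem measurableSet_Icc] with y hyB hyD hy
  rw [hyD, D_primitive hL hφc hy]
  -- Replacing `h'`, `h''` by their cut-offs is harmless off `[a,b]`: on the broken set `h'`
  -- vanishes and `h''` does so almost everywhere, and elsewhere the test function has zero
  -- derivatives.
  by_cases hab : y ∈ Icc a b
  · simp only [cutGrad, cutHess, indicator_of_mem hab]
  · have h1 : cutGrad L h a b y = 0 := indicator_of_notMem hab _
    have h2 : cutHess L h a b y = 0 := indicator_of_notMem hab _
    rw [h1, h2]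
    rcases hoff y hy hab with hb | ⟨h3, h4⟩
    · rw [hyB hb, hb.2]
    · rw [h3, h4]; ring

lemma intervalIntegrable_density (hW : ContDiffOn ℝ 2 (Wstar W) (Ici 0)) (hL : 0 ≤ L)
    {q z : ℝ → ℝ} (hq : MemH1 L q z) (hq0 : ∀ y ∈ Icc 0 L, 0 ≤ q y) :
    IntervalIntegrable (density W ε q z) volume 0 L := by
  refine ((MemLp.intervalIntegrable_sq hL hq.memLp).const_mul _).add ?_
  apply ContinuousOn.intervalIntegrable
  rw [uIcc_of_le hL]
  exact hW.continuousOn.comp (hq.continuousOn hL) hq0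

/-- Lower bound for the energy of a competitor supported near `[a,b]`. -/
lemma energy_comparison (hW : ContDiffOn ℝ 2 (Wstar W) (Ici 0)) (hL : 0 < L) (hK : h ∈ K L)
    (hEL : SolvesEL W ε L h)
    (hB : ∀ᵐ y ∂(volume.restrict (Icc 0 L)), y ∈ broken L h → D L (D L h) y = 0) {a b : ℝ}
    (hP : MemH1 L (cutGrad L h a b) (cutHess L h a b)) {q z : ℝ → ℝ} (hq : MemH1 L q z)
    (hq0 : ∀ y ∈ Icc 0 L, 0 ≤ q y)
    (hint : ∫ y in (0 : ℝ)..L, q y = ∫ y in (0 : ℝ)..L, cutGrad L h a b y)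
    (hoff : ∀ y ∈ Icc 0 L, y ∉ Icc a b → y ∈ broken L h ∨ (q y = 0 ∧ z y = 0))
    {m : ℝ → ℝ} (hm : ContinuousOn m (Icc 0 L))
    (hm' : ∀ y ∈ Icc 0 L, ∀ t ∈ uIcc (cutGrad L h a b y) (q y), m y ≤ Mstar W t) :
    (∫ y in (0 : ℝ)..L, density W ε (cutGrad L h a b) (cutHess L h a b) y) +
      1 / 2 * ∫ y in (0 : ℝ)..L, (ε ^ 2 * (z y - cutHess L h a b y) ^ 2 +
        m y * (q y - cutGrad L h a b y) ^ 2) ≤ ∫ y in (0 : ℝ)..L, density W ε q z y := by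
  have hφ := hq.sub hL.le hP
  have hφc := hφ.continuousOn hL.le
  have hP0 : ∀ y ∈ Icc 0 L, 0 ≤ cutGrad L h a b y := fun y hy => cutGrad_nonneg hK a b hy
  have h1 := firstVariation_nonneg hL hK hEL hB hP hq hq0 hint hoff
  have i1 := intervalIntegrable_density (ε := ε) hW hL.le hP hP0
  have i2 := intervalIntegrable_density (ε := ε) hW hL.le hq hq0
  have i3 : IntervalIntegrable (fun y => ε ^ 2 * cutHess L h a b y * (z y - cutHess L h a b y) +
      Sstar W (cutGrad L h a b y) * (q y - cutGrad L h a b y)) volume 0 L := by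
    simp_rw [mul_assoc]
    refine ((MemLp.intervalIntegrable_mul hL.le hP.memLp hφ.memLp).const_mul _).add ?_
    apply ContinuousOn.intervalIntegrable
    rw [uIcc_of_le hL.le]
    exact ((contDiffOn_Sstar hW).continuousOn.comp (hP.continuousOn hL.le) hP0).mul hφc
  have i4 : IntervalIntegrable (fun y => ε ^ 2 * (z y - cutHess L h a b y) ^ 2 +
        m y * (q y - cutGrad L h a b y) ^ 2) volume 0 L := by
    refine ((MemLp.intervalIntegrable_sq hL.le hφ.memLp).const_mul _).add ?_
    apply ContinuousOn.intervalIntegrable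
    rw [uIcc_of_le hL.le]
    exact hm.mul (hφc.pow 2)
  have h2 := intervalIntegral.integral_mono_on hL.le ((i1.add i3).add (i4.const_mul (1 / 2))) i2
    fun y hy => ?_
  · rw [intervalIntegral.integral_add (i1.add i3) (i4.const_mul (1 / 2)),
      intervalIntegral.integral_add i1 i3, intervalIntegral.integral_const_mul] at h2
    linarith
  -- The Hessian part expands exactly as a square; only the W* part needs the Taylor inequality.
  · have h3 := Wstar_taylor_le hW (hP0 y hy) (hq0 y hy) (hm' y hy)
    simp only [density]
    nlinarith

end comparison

/-! ### Structure of the crack set and behaviour of variations there -/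

section cracks

variable {L : ℝ} {h : ℝ → ℝ}

lemma crackFaces_subset_Ioo (hnd : NondegenerateCracks L h) : crackFaces L h ⊆ Ioo 0 L := by
  intro y hy
  obtain ⟨α, hα, ⟨h1, h2⟩ | ⟨h1, h2⟩⟩ := hnd y hy
  · have h3 := (h1 (show y + α / 2 ∈ Ico y (y + α) from ⟨by linarith, by linarith⟩)).1
    have h4 := (h2 (show y - α / 2 ∈ Ioo (y - α) y from ⟨by linarith, by linarith⟩)).1
    exact ⟨by linarith [h4.1], by linarith [h3.2]⟩
  · have h3 := (h1 (show y - α / 2 ∈ Ioc (y - α) y from ⟨by linarith, by linarith⟩)).1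
    have h4 := (h2 (show y + α / 2 ∈ Ioo y (y + α) from ⟨by linarith, by linarith⟩)).1
    exact ⟨by linarith [h3.1], by linarith [h4.2]⟩

lemma notMem_crackFaces {c d y : ℝ} (hy : y ∈ Ioo c d) (hcd : Ioo c d ∩ Icc 0 L ⊆ broken L h) :
    y ∉ crackFaces L h := by
  intro hyc
  refine hyc.2 ⟨min (y - c) (d - y) / 2, by
    have := lt_min (sub_pos.2 hy.1) (sub_pos.2 hy.2); linarith, fun x hx => hcd ⟨?_, hx.2⟩⟩
  have h0 := lt_min (sub_pos.2 hy.1) (sub_pos.2 hy.2)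
  have h1 := min_le_left (y - c) (d - y)
  have h2 := min_le_right (y - c) (d - y)
  exact ⟨by linarith [hx.1.1], by linarith [hx.1.2]⟩

/-- An accumulation point of crack faces is broken, since the broken set is closed, and is itself a
crack face, since no crack face lies inside an interval on which `h'` vanishes. Nondegeneracy at
that point leaves no room for other crack faces nearby. -/
lemma finite_crackFaces (hL : 0 < L) (hK : h ∈ K L) (hnd : NondegenerateCracks L h) :
    (crackFaces L h).Finite := by
  by_contra hinf
  have hsub : crackFaces L h ⊆ Icc 0 L := fun y hy => hy.1.1
  obtain ⟨x, -, hx⟩ := Set.Infinite.exists_accPt_of_subset_isCompact hinf isCompact_Icc hsub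
  rw [accPt_iff_nhds] at hx
  have hxB : x ∈ broken L h := by
    rw [← (broken_isClosed hL hK).closure_eq, mem_closure_iff_nhds]
    intro U hU
    obtain ⟨y, ⟨hyU, hyC⟩, -⟩ := hx U hU
    exact ⟨y, hyU, hyC.1⟩
  have hxC : x ∈ crackFaces L h := by
    refine ⟨hxB, fun ⟨α, hα, hB⟩ => ?_⟩
    obtain ⟨y, ⟨hyU, hyC⟩, -⟩ := hx (Ioo (x - α) (x + α)) (Ioo_mem_nhds (by linarith) (by linarith))
    exact notMem_crackFaces hyU (fun t ht => hB ⟨Ioo_subset_Icc_self ht.1, ht.2⟩) hyC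
  obtain ⟨α, hα, H⟩ := hnd x hxC
  obtain ⟨y, ⟨hyU, hyC⟩, hne⟩ := hx (Ioo (x - α) (x + α)) (Ioo_mem_nhds (by linarith) (by linarith))
  rcases lt_or_gt_of_ne hne with hlt | hlt <;> rcases H with ⟨h1, h2⟩ | ⟨h1, h2⟩
  · exact (h2 ⟨hyU.1, hlt⟩).2 hyC.1
  · exact notMem_crackFaces (c := x - α) (d := x) ⟨hyU.1, hlt⟩
      (fun t ht => h1 ⟨ht.1.1, ht.1.2.le⟩) hyC
  · exact notMem_crackFaces (c := x) (d := x + α) ⟨hlt, hyU.2⟩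
      (fun t ht => h1 ⟨ht.1.1.le, ht.1.2⟩) hyC
  · exact (h2 ⟨hlt, hyU.2⟩).2 hyC.1

/-- An interval without crack faces is either broken or unbroken. -/
lemma Ioo_subset_broken_or_good (hL : 0 < L) (hK : h ∈ K L) {c d : ℝ} (hc : 0 ≤ c) (hd : d ≤ L)
    (hcd : ∀ y ∈ Ioo c d, y ∉ crackFaces L h) : Ioo c d ⊆ broken L h ∨ Ioo c d ⊆ good L h := by
  have hsub : Ioo c d ⊆ Ioo 0 L := Ioo_subset_Ioo hc hd
  -- Without crack faces every broken point of the interval is interior to the broken set, so the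
  -- interval is covered by two disjoint open sets, and connectedness selects one.
  have := isPreconnected_Ioo.subset_or_subset (s := Ioo c d) (u := interior (broken L h))
    (v := (broken L h)ᶜ) isOpen_interior (broken_isClosed hL hK).isOpen_compl
    (disjoint_compl_right.mono_left interior_subset) ?_
  · refine this.imp (fun H => H.trans interior_subset) fun H y hy =>
      ⟨Ioo_subset_Icc_self (hsub hy), H hy⟩
  · intro y hy
    by_cases hyB : y ∈ broken L h
    · left
      have : ∃ α > 0, Icc (y - α) (y + α) ∩ Icc 0 L ⊆ broken L h := by
        by_contra hno; exact hcd y hy ⟨hyB, hno⟩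
      obtain ⟨α, hα, hB⟩ := this
      refine mem_interior_iff_mem_nhds.2 (mem_of_superset (inter_mem
        (Icc_mem_nhds (by linarith) (by linarith)) (Icc_mem_nhds (hsub hy).1 (hsub hy).2)) hB)
    · right; exact hyB

/-- Away from the finitely many crack faces, `h'` vanishes on a relative neighbourhood of each
broken point. -/
lemma ae_D_D_eq_zero (hL : 0 < L) (hK : h ∈ K L) (hnd : NondegenerateCracks L h) :
    ∀ᵐ y ∂(volume.restrict (Icc 0 L)), y ∈ broken L h → D L (D L h) y = 0 := by
  apply ae_restrict_of_ae
  have h0 : ∀ᵐ y : ℝ, y ∉ crackFaces L h := by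
    rw [ae_iff]; simpa using (finite_crackFaces hL hK hnd).measure_zero volume
  filter_upwards [h0] with y hyC hyB
  have : ∃ α > 0, Icc (y - α) (y + α) ∩ Icc 0 L ⊆ broken L h := by
    by_contra hno; exact hyC ⟨hyB, hno⟩
  obtain ⟨α, hα, hB⟩ := this
  have heq : D L h =ᶠ[𝓝[Icc 0 L] y] fun _ => 0 := by
    filter_upwards [self_mem_nhdsWithin,
      nhdsWithin_le_nhds (Icc_mem_nhds (show y - α < y by linarith) (show y < y + α by linarith))]
      with t ht ht'
    exact (hB ⟨ht', ht⟩).2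
  rw [D, heq.derivWithin_eq hyB.2]
  simp

/-- Finiteness of the crack faces provides a nearest one to the left; the end `0` serves when there
is none. -/
lemma exists_prev (hL : 0 < L) (hK : h ∈ K L) (hnd : NondegenerateCracks L h) {y : ℝ}
    (hy : 0 < y) : ∃ x, (x = 0 ∨ x ∈ crackFaces L h) ∧ 0 ≤ x ∧ x < y ∧
      ∀ t ∈ Ioo x y, t ∉ crackFaces L h := by
  have hfin : (insert 0 (crackFaces L h) ∩ Iio y).Finite :=
    ((finite_crackFaces hL hK hnd).insert 0).inter_of_left _
  obtain ⟨x, hx, hmax⟩ := Set.exists_max_image _ id hfin ⟨0, mem_insert _ _, hy⟩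
  refine ⟨x, hx.1, ?_, hx.2, fun t ht htC => ?_⟩
  · rcases hx.1 with rfl | hx
    · exact le_rfl
    · exact hx.1.1.1
  · exact absurd (hmax t ⟨mem_insert_of_mem _ htC, ht.2⟩) (not_le.2 ht.1)

lemma exists_next (hL : 0 < L) (hK : h ∈ K L) (hnd : NondegenerateCracks L h) {y : ℝ}
    (hy : y < L) : ∃ x, (x = L ∨ x ∈ crackFaces L h) ∧ x ≤ L ∧ y < x ∧
      ∀ t ∈ Ioo y x, t ∉ crackFaces L h := by
  have hfin : (insert L (crackFaces L h) ∩ Ioi y).Finite :=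
    ((finite_crackFaces hL hK hnd).insert L).inter_of_left _
  obtain ⟨x, hx, hmin⟩ := Set.exists_min_image _ id hfin ⟨L, mem_insert _ _, hy⟩
  refine ⟨x, hx.1, ?_, hx.2, fun t ht htC => ?_⟩
  · rcases hx.1 with rfl | hx
    · exact le_rfl
    · exact hx.1.1.2
  · exact absurd (hmin t ⟨mem_insert_of_mem _ htC, ht.1⟩) (not_le.2 ht.2)

/-- The orientation constraint makes `η'` nonnegative, and it is continuous with zero integral over
the interval. Irreversibility thereby upgrades the inequality to an equality. -/
lemma D_eq_zero_of_Icc_broken (hL : 0 < L) (hK : h ∈ K L) {η : ℝ → ℝ}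
    (hη : η ∈ admissibleVariations L h) {c d : ℝ} (hc : 0 ≤ c) (hcd : c < d) (hd : d ≤ L)
    (hB : Ioo c d ⊆ broken L h) (hηc : η c = 0) (hηd : η d = 0) :
    ∀ y ∈ Icc c d, D L η y = 0 := by
  have hB' : Icc c d ⊆ broken L h := by
    rw [← closure_Ioo hcd.ne]; exact closure_minimal hB (broken_isClosed hL hK)
  intro y hy
  by_contra hne
  have hpos := intervalIntegral.integral_pos hcd
    ((hη.1.1.continuousOn_D hL).mono (Icc_subset_Icc hc hd))
    (fun x hx => hη.2.1 x (hB' (Ioc_subset_Icc_self hx)))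
    ⟨y, hy, lt_of_le_of_ne (hη.2.1 y (hB' hy)) (Ne.symm hne)⟩
  rw [← hη.1.1.sub_eq_integral hL ⟨hc, hcd.le.trans hd⟩ ⟨hc.trans hcd.le, hd⟩, hηc, hηd,
    sub_self] at hpos
  exact lt_irrefl _ hpos

/-- Admissible variations have vanishing slope at the crack faces. -/
lemma D_eq_zero_of_mem_crackFaces (hL : 0 < L) (hK : h ∈ K L) (hnd : NondegenerateCracks L h)
    {η : ℝ → ℝ} (hη : η ∈ admissibleVariations L h) {y : ℝ} (hy : y ∈ crackFaces L h) :
    D L η y = 0 := by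
  have hyL := crackFaces_subset_Ioo hnd hy
  obtain ⟨α, hα, ⟨h1, -⟩ | ⟨h1, -⟩⟩ := hnd y hy
  · obtain ⟨x, hx, hxL, hyx, hC⟩ := exists_next hL hK hnd hyL.2
    have hηx : η x = 0 := by
      rcases hx with rfl | hx
      · exact hη.1.2.2
      · exact hη.2.2 x hx
    refine D_eq_zero_of_Icc_broken hL hK hη hyL.1.le hyx hxL ?_ (hη.2.2 y hy) hηx y
      ⟨le_rfl, hyx.le⟩
    refine (Ioo_subset_broken_or_good hL hK hyL.1.le hxL hC).resolve_right fun hg => ?_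
    obtain ⟨t, ht, ht'⟩ := exists_between (lt_min hyx (show y < y + α by linarith))
    exact (hg ⟨ht, ht'.trans_le (min_le_left _ _)⟩).2
      (h1 ⟨ht.le, ht'.trans_le (min_le_right _ _)⟩)
  · obtain ⟨x, hx, hxL, hyx, hC⟩ := exists_prev hL hK hnd hyL.1
    have hηx : η x = 0 := by
      rcases hx with rfl | hx
      · exact hη.1.2.1
      · exact hη.2.2 x hx
    refine D_eq_zero_of_Icc_broken hL hK hη hxL hyx hyL.2.le ?_ hηx (hη.2.2 y hy) y
      ⟨hyx.le, le_rfl⟩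
    refine (Ioo_subset_broken_or_good hL hK hxL hyL.2.le hC).resolve_right fun hg => ?_
    obtain ⟨t, ht, ht'⟩ := exists_between (max_lt hyx (show y - α < y by linarith))
    exact (hg ⟨(le_max_left _ _).trans_lt ht, ht'⟩).2
      (h1 ⟨(le_max_right _ _).trans_lt ht, ht'.le⟩)

lemma exists_broken_left (hnd : NondegenerateCracks L h) {a b : ℝ} (hab : a < b)
    (ha : a ∈ crackFaces L h) (hg : Ioo a b ⊆ good L h) :
    ∃ α > 0, Icc (a - α) a ⊆ broken L h := by
  obtain ⟨α, hα, ⟨h1, -⟩ | ⟨h1, -⟩⟩ := hnd a ha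
  · obtain ⟨t, ht, ht'⟩ := exists_between (lt_min hab (show a < a + α by linarith))
    exact absurd (h1 ⟨ht.le, ht'.trans_le (min_le_right _ _)⟩)
      (hg ⟨ht, ht'.trans_le (min_le_left _ _)⟩).2
  · exact ⟨α / 2, by linarith, fun t ht => h1 ⟨by linarith [ht.1], ht.2⟩⟩

lemma exists_broken_right (hnd : NondegenerateCracks L h) {a b : ℝ} (hab : a < b)
    (hb : b ∈ crackFaces L h) (hg : Ioo a b ⊆ good L h) :
    ∃ α > 0, Icc b (b + α) ⊆ broken L h := by
  obtain ⟨α, hα, ⟨h1, -⟩ | ⟨h1, -⟩⟩ := hnd b hb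
  · exact ⟨α / 2, by linarith, fun t ht => h1 ⟨ht.1, by linarith [ht.2]⟩⟩
  · obtain ⟨t, ht, ht'⟩ := exists_between (max_lt hab (show b - α < b by linarith))
    exact absurd (h1 ⟨(le_max_right _ _).trans_lt ht, ht'.le⟩)
      (hg ⟨(le_max_left _ _).trans_lt ht, ht'⟩).2

end cracks

/-! ### Cut-off functions and their translates -/

section cutoff

variable {L a b : ℝ} {p w : ℝ → ℝ}

lemma integral_indicator_Icc {c d : ℝ} (hc : c ≤ a) (hab : a ≤ b) (hd : b ≤ d) (f : ℝ → ℝ) :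
    ∫ t in c..d, (Icc a b).indicator f t = ∫ t in a..b, f t := by
  rw [intervalIntegral.integral_of_le (hc.trans (hab.trans hd)), ← integral_Icc_eq_integral_Ioc,
    setIntegral_indicator measurableSet_Icc,
    inter_eq_self_of_subset_right (Icc_subset_Icc hc hd), integral_Icc_eq_integral_Ioc,
    intervalIntegral.integral_of_le hab]

lemma integral_indicator_Icc_left {y : ℝ} (hy0 : 0 ≤ y) (hy : y < a) (f : ℝ → ℝ) :
    ∫ t in (0 : ℝ)..y, (Icc a b).indicator f t = 0 := by
  have : ∀ t ∈ uIcc 0 y, (Icc a b).indicator f t = (fun _ => (0 : ℝ)) t := by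
    intro t ht
    rw [uIcc_of_le hy0] at ht
    exact indicator_of_notMem (fun h => absurd (h.1.trans ht.2) (not_le.2 hy)) _
  rw [intervalIntegral.integral_congr this]; simp

lemma integral_indicator_Icc_mid {y : ℝ} (ha : 0 ≤ a) (hy : y ∈ Icc a b) (f : ℝ → ℝ) :
    ∫ t in (0 : ℝ)..y, (Icc a b).indicator f t = ∫ t in a..y, f t := by
  rw [← integral_indicator_Icc ha hy.1 (le_refl y)]
  apply intervalIntegral.integral_congr
  intro t ht
  rw [uIcc_of_le (ha.trans hy.1)] at ht
  by_cases hta : a ≤ t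
  · rw [indicator_of_mem (show t ∈ Icc a b from ⟨hta, ht.2.trans hy.2⟩),
      indicator_of_mem (show t ∈ Icc a y from ⟨hta, ht.2⟩)]
  · rw [indicator_of_notMem fun h => hta h.1, indicator_of_notMem fun h => hta h.1]

lemma MemH1.indicator (hL : 0 ≤ L) (hp : MemH1 L p w) (ha : 0 ≤ a) (hab : a ≤ b) (hb : b ≤ L)
    (hpa : a = 0 ∨ p a = 0) (hpb : b = L ∨ p b = 0) :
    MemH1 L ((Icc a b).indicator p) ((Icc a b).indicator w) := by
  refine ⟨hp.memLp.indicator measurableSet_Icc, fun y hy => ?_⟩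
  have haL : a ∈ Icc 0 L := ⟨ha, hab.trans hb⟩
  have h0 : (Icc a b).indicator p 0 = p a := by
    rcases ha.eq_or_lt with rfl | ha'
    · exact indicator_of_mem (show (0 : ℝ) ∈ Icc 0 b from ⟨le_rfl, hab⟩) _
    · rw [indicator_of_notMem fun h => absurd h.1 (not_le.2 ha')]
      exact (hpa.resolve_left ha'.ne').symm
  rw [h0]
  rcases lt_or_ge y a with hya | hya
  · rw [integral_indicator_Icc_left hy.1 hya, indicator_of_notMem fun h => absurd h.1 (not_le.2 hya),
      hpa.resolve_left (hy.1.trans_lt hya).ne', add_zero]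
  rcases le_or_gt y b with hyb | hyb
  · rw [integral_indicator_Icc_mid ha ⟨hya, hyb⟩, indicator_of_mem (show y ∈ Icc a b from ⟨hya, hyb⟩),
      ← hp.sub_eq_integral hL haL hy]
    ring
  · rw [integral_indicator_Icc ha hab hyb.le, indicator_of_notMem fun h => absurd h.2 (not_le.2 hyb),
      ← hp.sub_eq_integral hL haL ⟨ha.trans hab, hb⟩, hpb.resolve_left (hyb.trans_le hy.2).ne]
    ring

/-- For a function vanishing at interior points `a`, `b`, the cut-off function is a primitive on the
whole line. -/
lemma MemH1.indicator_eq_integral (hL : 0 ≤ L) (hp : MemH1 L p w) (ha : 0 < a) (hab : a ≤ b)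
    (hb : b < L) (hpa : p a = 0) (hpb : p b = 0) (y : ℝ) :
    (Icc a b).indicator p y = ∫ t in (0 : ℝ)..y, (Icc a b).indicator w t := by
  have haL : a ∈ Icc 0 L := ⟨ha.le, hab.trans hb.le⟩
  rcases lt_or_ge y 0 with hy0 | hy0
  · have : ∀ t ∈ uIcc 0 y, (Icc a b).indicator w t = (fun _ => (0 : ℝ)) t := by
      intro t ht
      rw [uIcc_of_ge hy0.le] at ht
      exact indicator_of_notMem (fun h => by linarith [h.1, ht.2]) _
    rw [intervalIntegral.integral_congr this,
      indicator_of_notMem (fun h => by linarith [h.1])]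
    simp
  rcases lt_or_ge y a with hya | hya
  · rw [integral_indicator_Icc_left hy0 hya, indicator_of_notMem fun h => absurd h.1 (not_le.2 hya)]
  rcases le_or_gt y b with hyb | hyb
  · rw [integral_indicator_Icc_mid ha.le ⟨hya, hyb⟩, indicator_of_mem (show y ∈ Icc a b from ⟨hya, hyb⟩),
      ← hp.sub_eq_integral hL haL ⟨hy0, hyb.trans hb.le⟩, hpa, sub_zero]
  · rw [integral_indicator_Icc ha.le hab hyb.le, indicator_of_notMem fun h => absurd h.2 (not_le.2 hyb),
      ← hp.sub_eq_integral hL haL ⟨ha.le.trans hab, hb.le⟩, hpa, hpb, sub_zero]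

end cutoff

section shift

variable {L a b : ℝ} {p w : ℝ → ℝ}

lemma memLp_indicator (hw : MemLp w 2 (volume.restrict (Icc 0 L))) (ha : 0 ≤ a) (hb : b ≤ L) :
    MemLp ((Icc a b).indicator w) 2 volume := by
  rw [memLp_indicator_iff_restrict measurableSet_Icc]
  exact hw.mono_measure (Measure.restrict_mono (Icc_subset_Icc ha hb) le_rfl)

lemma intervalIntegrable_of_memLp {f : ℝ → ℝ} (hf : MemLp f 2 volume) (c d : ℝ) :
    IntervalIntegrable f volume c d := by
  rw [intervalIntegrable_iff, uIoc]
  exact (hf.restrict _).integrable (by norm_num)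

lemma intervalIntegrable_sq_of_memLp {f : ℝ → ℝ} (hf : MemLp f 2 volume) (c d : ℝ) :
    IntervalIntegrable (fun y => f y ^ 2) volume c d := hf.integrable_sq.intervalIntegrable

/-- Translates of a cut-off function vanishing at the interior points `a` and `b`. -/
lemma MemH1.indicator_shift (hL : 0 ≤ L) (hp : MemH1 L p w) (ha : 0 < a) (hab : a ≤ b)
    (hb : b < L) (hpa : p a = 0) (hpb : p b = 0) (τ : ℝ) :
    MemH1 L (fun y => (Icc a b).indicator p (y + τ)) (fun y => (Icc a b).indicator w (y + τ)) := by
  have hw := memLp_indicator hp.memLp ha.le hb.le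
  refine ⟨(hw.comp_measurePreserving (measurePreserving_add_right volume τ)).restrict _,
    fun y _ => ?_⟩
  rw [hp.indicator_eq_integral hL ha hab hb hpa hpb, hp.indicator_eq_integral hL ha hab hb hpa hpb,
    intervalIntegral.integral_comp_add_right (fun t => (Icc a b).indicator w t), zero_add,
    intervalIntegral.integral_add_adjacent_intervals (intervalIntegrable_of_memLp hw _ _)
      (intervalIntegrable_of_memLp hw _ _)]

lemma integral_indicator_shift {τ : ℝ} (hab : a ≤ b) (hτa : τ ≤ a) (hτb : b ≤ L + τ)
    (f : ℝ → ℝ) : ∫ y in (0 : ℝ)..L, (Icc a b).indicator f (y + τ) = ∫ y in a..b, f y := by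
  rw [intervalIntegral.integral_comp_add_right (fun t => (Icc a b).indicator f t), zero_add,
    integral_indicator_Icc hτa hab hτb]

/-- Since W*(0) = 0, a cut-off gradient carries no energy outside `[a,b]`; hence its energy is
unchanged by translations that stay inside the bar. -/
lemma density_cut (W : ℝ → ℝ) (ε : ℝ) (g : ℝ → ℝ) :
    density W ε (cutGrad L g a b) (cutHess L g a b) =
      (Icc a b).indicator (density W ε (D L g) (D L (D L g))) := by
  funext y
  by_cases hy : y ∈ Icc a b
  · simp [density, cutGrad, cutHess, indicator_of_mem hy]
  · simp [density, cutGrad, cutHess, indicator_of_notMem hy, Wstar_zero]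

/-- The difference of a primitive and its translate is of the order of the translation in `L²`. -/
lemma integral_sq_shift_sub_le {f F : ℝ → ℝ} (hL : 0 ≤ L) (hf : MemLp f 2 volume)
    (hF : ∀ y, F y = ∫ t in (0 : ℝ)..y, f t) (hf0 : ∀ y, L < y → f y = 0) {τ : ℝ} (hτ : 0 < τ) :
    ∫ y in (0 : ℝ)..L, (F (y + τ) - F y) ^ 2 ≤ τ ^ 2 * ∫ t in (0 : ℝ)..L, f t ^ 2 := by
  set B : ℝ → ℝ := fun y => ∫ t in (0 : ℝ)..y, f t ^ 2 with hB
  have hi := intervalIntegrable_of_memLp hf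
  have hi2 := intervalIntegrable_sq_of_memLp hf
  have hBc : Continuous B := intervalIntegral.continuous_primitive hi2 0
  have hFc : Continuous F := by
    rw [funext hF]; exact intervalIntegral.continuous_primitive hi 0
  have hBi : ∀ c d, IntervalIntegrable B volume c d := fun c d => hBc.intervalIntegrable c d
  -- Cauchy-Schwarz on `[y, y+τ]`. Integrating in `y`, the right side telescopes to integrals of `B`
  -- over two intervals of length `τ`, and `B` is constant beyond `L`.
  have h1 : ∀ y, (F (y + τ) - F y) ^ 2 ≤ τ * (B (y + τ) - B y) := by
    intro y
    have e1 : F (y + τ) - F y = ∫ t in y..(y + τ), f t := by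
      rw [hF, hF, intervalIntegral.integral_interval_sub_left (hi _ _) (hi _ _)]
    have e2 : B (y + τ) - B y = ∫ t in y..(y + τ), f t ^ 2 := by
      rw [hB]; exact intervalIntegral.integral_interval_sub_left (hi2 _ _) (hi2 _ _)
    rw [e1, e2]
    simpa using sq_integral_le (by linarith : y ≤ y + τ) (hi _ _) (hi2 _ _)
  have hBL : ∀ y ∈ Icc L (L + τ), B y = B L := by
    intro y hy
    have : B y - B L = ∫ t in L..y, f t ^ 2 :=
      intervalIntegral.integral_interval_sub_left (hi2 _ _) (hi2 _ _)
    have h0 : ∫ t in L..y, f t ^ 2 = 0 := by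
      rw [intervalIntegral.integral_of_le hy.1]
      apply setIntegral_eq_zero_of_forall_eq_zero
      intro t ht; rw [hf0 t ht.1]; ring
    linarith
  calc ∫ y in (0 : ℝ)..L, (F (y + τ) - F y) ^ 2
      ≤ ∫ y in (0 : ℝ)..L, τ * (B (y + τ) - B y) :=
        intervalIntegral.integral_mono_on hL
          (Continuous.intervalIntegrable (by fun_prop) _ _)
          (Continuous.intervalIntegrable (by fun_prop) _ _) fun y _ => h1 y
    _ = τ * ((∫ y in L..(L + τ), B y) - ∫ y in (0 : ℝ)..τ, B y) := by
        rw [intervalIntegral.integral_const_mul, intervalIntegral.integral_sub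
          (Continuous.intervalIntegrable (by fun_prop) _ _) (hBi _ _),
          intervalIntegral.integral_comp_add_right B, zero_add]
        have e1 := intervalIntegral.integral_add_adjacent_intervals (hBi τ L) (hBi L (L + τ))
        have e2 := intervalIntegral.integral_add_adjacent_intervals (hBi 0 τ) (hBi τ L)
        rw [← e1, ← e2]; ring
    _ ≤ τ * (τ * B L) := by
        have e1 : ∫ y in L..(L + τ), B y = τ * B L := by
          have : ∀ y ∈ uIcc L (L + τ), B y = (fun _ => B L) y := by
            intro y hy; rw [uIcc_of_le (by linarith)] at hy; exact hBL y hy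
          rw [intervalIntegral.integral_congr this]; simp
        have e2 : 0 ≤ ∫ y in (0 : ℝ)..τ, B y :=
          intervalIntegral.integral_nonneg hτ.le fun y hy =>
            intervalIntegral.integral_nonneg hy.1 fun _ _ => sq_nonneg _
        rw [e1]
        exact mul_le_mul_of_nonneg_left (by linarith) hτ.le
    _ = τ ^ 2 * ∫ t in (0 : ℝ)..L, f t ^ 2 := by rw [hB]; ring

end shift

/-! ### Regularity and admissibility of the translation modes -/

section unbrokenPart

variable {W : ℝ → ℝ} {ε L : ℝ} {h : ℝ → ℝ} {r s : ℝ}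

/-- Each end of the part has its unbroken side inside, so nondegeneracy puts a broken interval
outside. This margin is the room in which the part can be translated. -/
lemma IsUnbrokenPart.exists_margin (hnd : NondegenerateCracks L h) (hrs : IsUnbrokenPart L h r s) :
    ∃ ρ > 0, Icc (r - ρ) r ⊆ broken L h ∧ Icc s (s + ρ) ⊆ broken L h := by
  obtain ⟨hr, hs, hlt, hg⟩ := hrs
  obtain ⟨α, hα, h1⟩ := exists_broken_left hnd hlt hr hg
  obtain ⟨β, hβ, h2⟩ := exists_broken_right hnd hlt hs hg
  refine ⟨min α β, lt_min hα hβ, fun t ht => h1 ⟨?_, ht.2⟩, fun t ht => h2 ⟨ht.1, ?_⟩⟩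
  · linarith [ht.1, min_le_left α β]
  · linarith [ht.2, min_le_right α β]

lemma exists_bound_D (hL : 0 < L) {g : ℝ → ℝ} (hg : MemH2 L g) :
    ∃ R, 0 ≤ R ∧ ∀ y ∈ Icc 0 L, D L g y ≤ R := by
  obtain ⟨R, hR⟩ := (isCompact_Icc (a := (0 : ℝ)) (b := L)).bddAbove_image (hg.continuousOn_D hL)
  exact ⟨max R 0, le_max_right _ _, fun y hy =>
    (hR (mem_image_of_mem _ hy)).trans (le_max_left _ _)⟩

lemma exists_bound_Mstar (hW : ContDiffOn ℝ 2 (Wstar W) (Ici 0)) (R : ℝ) :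
    ∃ C, 0 ≤ C ∧ ∀ t ∈ Icc 0 R, |Mstar W t| ≤ C := by
  obtain ⟨C, hC⟩ := (isCompact_Icc (a := (0 : ℝ)) (b := R)).exists_bound_of_continuousOn
    ((continuousOn_Mstar hW).mono fun t ht => ht.1)
  exact ⟨max C 0, le_max_right _ _, fun t ht => (hC t ht).trans (le_max_left _ _)⟩

/-- A shift by at most `ρ` can bring into `[r,s]` only outside points lying in the two broken
margins, so translates satisfy the support condition of the energy comparison. -/
lemma shift_off {ρ τ : ℝ} (hl : Icc (r - ρ) r ⊆ broken L h) (hr : Icc s (s + ρ) ⊆ broken L h)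
    (hτ : |τ| ≤ ρ) (f g : ℝ → ℝ) {y : ℝ} (hy : y ∉ Icc r s) :
    y ∈ broken L h ∨ ((Icc r s).indicator f (y + τ) = 0 ∧ (Icc r s).indicator g (y + τ) = 0) := by
  by_cases hm : y + τ ∈ Icc r s
  · left
    have := abs_le.1 hτ
    rcases lt_or_ge y r with h1 | h1
    · exact hl ⟨by linarith [hm.1], h1.le⟩
    · have h2 : s < y := lt_of_not_ge fun h2 => hy ⟨h1, h2⟩
      exact hr ⟨h2.le, by linarith [hm.2]⟩
  · right; exact ⟨indicator_of_notMem hm _, indicator_of_notMem hm _⟩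

lemma cutGrad_mem_Icc {g : ℝ → ℝ} (hg : ∀ y ∈ Icc 0 L, 0 ≤ D L g y) {R : ℝ} (hR0 : 0 ≤ R)
    (hR : ∀ y ∈ Icc 0 L, D L g y ≤ R) (hr : 0 ≤ r) (hs : s ≤ L) (y : ℝ) :
    cutGrad L g r s y ∈ Icc 0 R := by
  unfold cutGrad
  by_cases hm : y ∈ Icc r s
  · have hy : y ∈ Icc 0 L := ⟨hr.trans hm.1, hm.2.trans hs⟩
    rw [indicator_of_mem hm]; exact ⟨hg y hy, hR y hy⟩
  · rw [indicator_of_notMem hm]; exact ⟨le_rfl, hR0⟩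

/-- Regularity: on an unbroken part between two cracks, `h'`, extended by zero, is in `H²`. -/
lemma exists_memH1_derivative (hW : ContDiffOn ℝ 2 (Wstar W) (Ici 0)) (hε : 0 < ε) (hL : 0 < L)
    (hK : h ∈ K L) (hEL : SolvesEL W ε L h) (hnd : NondegenerateCracks L h)
    (hrs : IsUnbrokenPart L h r s) :
    ∃ v u, MemH1 L v u ∧ ∀ y ∈ Icc 0 L, HasDerivWithinAt (cutGrad L h r s) (v y) (Icc 0 L) y := by
  obtain ⟨ρ, hρ, hBl, hBr⟩ := hrs.exists_margin hnd
  obtain ⟨hr, hs, hlt, -⟩ := hrs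
  have hr' := crackFaces_subset_Ioo hnd hr
  have hs' := crackFaces_subset_Ioo hnd hs
  have hρr : 0 ≤ r - ρ := (hBl ⟨le_rfl, by linarith⟩).1.1
  have hρs : s + ρ ≤ L := (hBr ⟨by linarith, le_rfl⟩).1.2
  have hp := hK.1.memH1 hL
  have hP : MemH1 L (cutGrad L h r s) (cutHess L h r s) :=
    hp.indicator hL.le hr'.1.le hlt.le hs'.2.le (Or.inr hr.1.2) (Or.inr hs.1.2)
  have hPint : ∀ y, cutGrad L h r s y = ∫ t in (0 : ℝ)..y, cutHess L h r s t :=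
    hp.indicator_eq_integral hL.le hr'.1 hlt.le hs'.2 hr.1.2 hs.1.2
  have hwL : MemLp (cutHess L h r s) 2 volume := memLp_indicator hp.memLp hr'.1.le hs'.2.le
  have hB := ae_D_D_eq_zero hL hK hnd
  obtain ⟨R, hR0, hR⟩ := exists_bound_D hL hK.1
  obtain ⟨C, hC0, hC⟩ := exists_bound_Mstar hW R
  have hmem := cutGrad_mem_Icc hK.2.2.2 hR0 hR hr'.1.le hs'.2.le
  set P := cutGrad L h r s with hPdef
  set w := cutHess L h r s with hwdef
  set A := ∫ t in (0 : ℝ)..L, w t ^ 2 with hA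
  have hA0 : 0 ≤ A := intervalIntegral.integral_nonneg hL.le fun _ _ => sq_nonneg _
  have hbound : ∀ τ, 0 < τ → τ ≤ ρ →
      ∫ y in (0 : ℝ)..L, (τ⁻¹ * (w (y + τ) - w y)) ^ 2 ≤ C * A / ε ^ 2 := by
    intro τ hτ hτρ
    have hq : MemH1 L (fun y => P (y + τ)) (fun y => w (y + τ)) :=
      hp.indicator_shift hL.le hr'.1 hlt.le hs'.2 hr.1.2 hs.1.2 τ
    have hφ := hq.sub hL.le hP
    have hint : ∫ y in (0 : ℝ)..L, P (y + τ) = ∫ y in (0 : ℝ)..L, P y := by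
      rw [hPdef, cutGrad, integral_indicator_shift hlt.le (by linarith) (by linarith),
        integral_indicator_Icc hr'.1.le hlt.le hs'.2.le]
    have hcmp := energy_comparison hW hL hK hEL hB hP hq (fun y _ => (hmem (y + τ)).1) hint
      (fun y _ hy => shift_off hBl hBr (abs_le.2 ⟨by linarith, hτρ⟩) _ _ hy)
      (m := fun _ => -C) continuousOn_const (fun y _ t ht =>
        neg_le_of_abs_le (hC t (ordConnected_Icc.uIcc_subset (hmem y) (hmem (y + τ)) ht)))
    -- The translate has the same energy as `P`, so the comparison with constant lower bound `-C`
    -- leaves `ε² ∫ (w(·+τ) - w)² ≤ C ∫ (P(·+τ) - P)²`, and the right side is at most `C τ² A`.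
    have heq : ∫ y in (0 : ℝ)..L, density W ε (fun y => P (y + τ)) (fun y => w (y + τ)) y =
        ∫ y in (0 : ℝ)..L, density W ε P w y := by
      have h1 : ∀ y, density W ε (fun y => P (y + τ)) (fun y => w (y + τ)) y =
          density W ε P w (y + τ) := fun y => rfl
      simp_rw [h1]
      rw [hPdef, hwdef, density_cut, integral_indicator_shift hlt.le (by linarith) (by linarith),
        integral_indicator_Icc hr'.1.le hlt.le hs'.2.le]
    rw [heq] at hcmp
    have i1 := MemLp.intervalIntegrable_sq hL.le hφ.memLp
    have i2 := hφ.intervalIntegrable_sq_left hL.le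
    rw [intervalIntegral.integral_add (i1.const_mul _) (i2.const_mul _),
      intervalIntegral.integral_const_mul, intervalIntegral.integral_const_mul] at hcmp
    have h2 := integral_sq_shift_sub_le hL.le hwL hPint
      (fun y hy => indicator_of_notMem (fun h => by linarith [h.2, hs'.2]) _) hτ
    simp_rw [mul_pow]
    rw [intervalIntegral.integral_const_mul, le_div_iff₀ (by positivity)]
    have h3 : ε ^ 2 * ∫ y in (0 : ℝ)..L, (w (y + τ) - w y) ^ 2 ≤ C * (τ ^ 2 * A) := by
      nlinarith [mul_le_mul_of_nonneg_left h2 hC0]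
    calc τ⁻¹ ^ 2 * (∫ y in (0 : ℝ)..L, (w (y + τ) - w y) ^ 2) * ε ^ 2
        = τ⁻¹ ^ 2 * (ε ^ 2 * ∫ y in (0 : ℝ)..L, (w (y + τ) - w y) ^ 2) := by ring
      _ ≤ τ⁻¹ ^ 2 * (C * (τ ^ 2 * A)) := mul_le_mul_of_nonneg_left h3 (by positivity)
      _ = C * A := by field_simp
  set τ : ℕ → ℝ := fun n => ρ / (n + 1) with hτdef
  have hτ0 : ∀ n, 0 < τ n := fun n => by positivity
  have hτρ : ∀ n, τ n ≤ ρ := fun n => div_le_self hρ.le (by linarith [n.cast_nonneg (α := ℝ)])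
  have hτlim : Tendsto τ atTop (𝓝[≠] 0) := by
    refine tendsto_nhdsWithin_iff.2 ⟨?_, Eventually.of_forall fun n => (hτ0 n).ne'⟩
    exact tendsto_const_div_atTop_nhds_zero_nat ρ |>.comp (tendsto_add_atTop_nat 1) |>.congr
      fun n => by simp [hτdef]
  have hP00 : ∀ n, P (0 + τ n) - P 0 = 0 := by
    intro n
    have h1 : P 0 = 0 := indicator_of_notMem (fun h => by linarith [h.1, hr'.1]) _
    have h2 : P (0 + τ n) = 0 := by
      by_cases hm : 0 + τ n ∈ Icc r s
      · have := hτρ n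
        have h3 : 0 + τ n = r := le_antisymm (by linarith) hm.1
        rw [h3]; exact cutGrad_broken hr.1
      · exact indicator_of_notMem hm _
    rw [h1, h2, sub_zero]
  obtain ⟨σ, hσ, v, u, hv, hlim, -⟩ := exists_subseq_memH1 (C := C * A / ε ^ 2) hL.le
    (q := fun n y => (τ n)⁻¹ * (P (y + τ n) - P y))
    (z := fun n y => (τ n)⁻¹ * (w (y + τ n) - w y))
    (fun n => ((hp.indicator_shift hL.le hr'.1 hlt.le hs'.2 hr.1.2 hs.1.2 (τ n)).sub
      hL.le hP).const_mul _)
    (fun n => by rw [hP00]; simp only [mul_zero, abs_zero]; positivity)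
    (fun n => hbound _ (hτ0 n) (hτρ n))
  refine ⟨v, u, hv, fun y hy => ?_⟩
  -- The difference quotients of `P` converge almost everywhere to `P' = w`, and along the
  -- subsequence everywhere on `[0,L]` to `v`. So `P` is a primitive of the continuous function `v`.
  have hae : ∀ᵐ y, y ∈ Icc 0 L → w y = v y := by
    have hi := intervalIntegrable_of_memLp hwL 0 L
    filter_upwards [hi.ae_hasDerivAt_integral] with y hd hy
    have hd' := hd (by rwa [uIcc_of_le hL.le]) 0 (by simp)
    rw [← funext hPint] at hd'
    have h1 := (hd'.tendsto_slope_zero).comp (hτlim.comp hσ.tendsto_atTop)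
    exact tendsto_nhds_unique h1 (hlim y hy)
  have hPv : ∀ y ∈ Icc 0 L, P y = ∫ t in (0 : ℝ)..y, v t := by
    intro y hy
    rw [hPint]
    apply intervalIntegral.integral_congr_ae
    filter_upwards [hae] with t ht ht'
    rw [uIoc_of_le hy.1] at ht'
    exact ht ⟨ht'.1.le, ht'.2.trans hy.2⟩
  exact (hasDerivWithinAt_primitive hL (hv.continuousOn hL.le) hy).congr hPv (hPv y hy)

lemma translationMode_eq_cutGrad (hrs : IsUnbrokenPart L h r s) :
    translationMode L h r s = cutGrad L h r s := by
  funext y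
  unfold translationMode cutGrad
  by_cases hy : y ∈ Ioo r s
  · rw [indicator_of_mem hy, indicator_of_mem (Ioo_subset_Icc_self hy)]
  · rw [indicator_of_notMem hy]
    by_cases hy' : y ∈ Icc r s
    · rw [indicator_of_mem hy']
      rcases hy'.1.eq_or_lt with rfl | h1
      · exact hrs.1.1.2.symm
      rcases hy'.2.eq_or_lt with rfl | h2
      · exact hrs.2.1.1.2.symm
      · exact absurd ⟨h1, h2⟩ hy
    · rw [indicator_of_notMem hy']

/-- The translation modes are admissible variations. -/
lemma translationMode_mem (hW : ContDiffOn ℝ 2 (Wstar W) (Ici 0)) (hε : 0 < ε) (hL : 0 < L)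
    (hK : h ∈ K L) (hEL : SolvesEL W ε L h) (hnd : NondegenerateCracks L h)
    (hrs : IsUnbrokenPart L h r s) : translationMode L h r s ∈ restrictedVariations L h := by
  obtain ⟨v, u, hv, hd⟩ := exists_memH1_derivative hW hε hL hK hEL hnd hrs
  rw [translationMode_eq_cutGrad hrs]
  have hr' := crackFaces_subset_Ioo hnd hrs.1
  have hs' := crackFaces_subset_Ioo hnd hrs.2.1
  have hD : ∀ y ∈ broken L h, D L (cutGrad L h r s) y = 0 := by
    intro y hy
    by_cases hm : y ∈ Icc r s
    · have hy' : Icc 0 L ∈ 𝓝 y :=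
        Icc_mem_nhds (hr'.1.trans_le hm.1) (hm.2.trans_lt hs'.2)
      -- At a broken point the nonnegative cut-off gradient attains its minimum zero.
      have hmin : IsLocalMin (cutGrad L h r s) y := by
        filter_upwards [hy'] with t ht
        rw [cutGrad_broken hy]; exact cutGrad_nonneg hK _ _ ht
      rw [D, derivWithin_of_mem_nhds hy', hmin.deriv_eq_zero]
    · have heq : cutGrad L h r s =ᶠ[𝓝[Icc 0 L] y] fun _ => 0 := by
        filter_upwards [nhdsWithin_le_nhds (isClosed_Icc.isOpen_compl.mem_nhds hm)] with t ht
        exact indicator_of_notMem ht _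
      rw [D, heq.derivWithin_eq (indicator_of_notMem hm _)]
      simp
  refine ⟨⟨⟨memH2_of_D hL hv hd, ?_, ?_⟩, fun y hy => (hD y hy).ge,
    fun y hy => cutGrad_broken hy.1⟩, hD, fun y hy => cutGrad_broken hy⟩
  · exact indicator_of_notMem (fun h => by linarith [h.1, hr'.1]) _
  · exact indicator_of_notMem (fun h => by linarith [h.2, hs'.2]) _

end unbrokenPart

/-! ### Compactness of nearby competitors -/

lemma tendsto_integral_of_bounded {f : ℕ → ℝ → ℝ} {F : ℝ → ℝ} {B y : ℝ} (hy : 0 ≤ y)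
    (hc : ∀ n, ContinuousOn (f n) (Icc 0 y)) (hb : ∀ n, ∀ t ∈ Icc 0 y, |f n t| ≤ B)
    (hl : ∀ t ∈ Icc 0 y, Tendsto (fun n => f n t) atTop (𝓝 (F t))) :
    Tendsto (fun n => ∫ t in (0 : ℝ)..y, f n t) atTop (𝓝 (∫ t in (0 : ℝ)..y, F t)) := by
  have hsub : uIoc 0 y ⊆ Icc 0 y := by rw [uIoc_of_le hy]; exact Ioc_subset_Icc_self
  apply intervalIntegral.tendsto_integral_filter_of_dominated_convergence (fun _ => B)
  · exact Eventually.of_forall fun n =>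
      ((hc n).mono hsub).aestronglyMeasurable measurableSet_uIoc
  · exact Eventually.of_forall fun n => Eventually.of_forall fun t ht => hb n t (hsub ht)
  · exact intervalIntegrable_const
  · exact Eventually.of_forall fun t ht => hl t (hsub ht)

/-- Compactness for the quadratic form `∫ ε² u² + m φ²`: functions on which the form is
asymptotically nonpositive converge, after normalization in `L²`, to one on which it is
nonpositive. -/
lemma exists_limit_of_form_neg {L ε C : ℝ} (hL : 0 < L) (hε : 0 < ε) {m : ℝ → ℝ}
    (hm : ContinuousOn m (Icc 0 L)) (hC : ∀ y ∈ Icc 0 L, |m y| ≤ C) {φ u : ℕ → ℝ → ℝ}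
    (hφ : ∀ n, MemH1 L (φ n) (u n))
    (hneg : ∀ n : ℕ, ∫ y in (0 : ℝ)..L, (ε ^ 2 * u n y ^ 2 + (m y - 1 / (n + 1)) * φ n y ^ 2) < 0) :
    ∃ σ : ℕ → ℕ, StrictMono σ ∧ ∃ (c : ℕ → ℝ) (B : ℝ) (p w : ℝ → ℝ), MemH1 L p w ∧
      (∀ n, ∀ y ∈ Icc 0 L, |c n * φ (σ n) y| ≤ B) ∧
      (∀ y ∈ Icc 0 L, Tendsto (fun n => c n * φ (σ n) y) atTop (𝓝 (p y))) ∧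
      ∫ y in (0 : ℝ)..L, p y ^ 2 = 1 ∧
      ∫ y in (0 : ℝ)..L, (ε ^ 2 * w y ^ 2 + m y * p y ^ 2) ≤ 0 := by
  have hC0 : 0 ≤ C := (abs_nonneg _).trans (hC 0 ⟨le_rfl, hL.le⟩)
  have ci : ∀ {f : ℝ → ℝ}, ContinuousOn f (Icc 0 L) → IntervalIntegrable f volume 0 L := by
    intro f hf; apply ContinuousOn.intervalIntegrable; rwa [uIcc_of_le hL.le]
  set N : ℕ → ℝ := fun n => ∫ y in (0 : ℝ)..L, φ n y ^ 2 with hN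
  have iu : ∀ n, IntervalIntegrable (fun y => u n y ^ 2) volume 0 L :=
    fun n => MemLp.intervalIntegrable_sq hL.le (hφ n).memLp
  have iφ : ∀ n, IntervalIntegrable (fun y => φ n y ^ 2) volume 0 L :=
    fun n => (hφ n).intervalIntegrable_sq_left hL.le
  have im : ∀ n, IntervalIntegrable (fun y => m y * φ n y ^ 2) volume 0 L :=
    fun n => ci (hm.mul (((hφ n).continuousOn hL.le).pow 2))
  have hsplit : ∀ n : ℕ, ε ^ 2 * (∫ y in (0 : ℝ)..L, u n y ^ 2) +
      (∫ y in (0 : ℝ)..L, m y * φ n y ^ 2) - 1 / (n + 1) * N n < 0 := by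
    intro n
    have h1 := hneg n
    simp_rw [sub_mul] at h1
    rwa [intervalIntegral.integral_add ((iu n).const_mul _) ((im n).sub ((iφ n).const_mul _)),
      intervalIntegral.integral_sub (im n) ((iφ n).const_mul _),
      intervalIntegral.integral_const_mul, intervalIntegral.integral_const_mul, ← add_sub_assoc]
      at h1
  have hu0 : ∀ n, 0 ≤ ∫ y in (0 : ℝ)..L, u n y ^ 2 :=
    fun n => intervalIntegral.integral_nonneg hL.le fun _ _ => sq_nonneg _
  have hN0 : ∀ n, 0 ≤ N n :=
    fun n => intervalIntegral.integral_nonneg hL.le fun _ _ => sq_nonneg _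
  have hmN : ∀ n, -(C * N n) ≤ ∫ y in (0 : ℝ)..L, m y * φ n y ^ 2 := by
    intro n
    rw [hN, ← intervalIntegral.integral_const_mul, ← intervalIntegral.integral_neg]
    apply intervalIntegral.integral_mono_on hL.le ((iφ n).const_mul _).neg (im n)
    intro y hy
    simp only [Pi.neg_apply]
    nlinarith [neg_le_of_abs_le (hC y hy), sq_nonneg (φ n y)]
  -- If `φ` had zero L² norm, the lower order part of the form would be nonnegative and the form
  -- could not be negative.
  have hNpos : ∀ n, 0 < N n := by
    intro n
    rcases (hN0 n).eq_or_lt with h0 | h0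
    · have h1 := hsplit n
      have h2 := hmN n
      rw [← h0] at h1 h2
      nlinarith [mul_nonneg (sq_nonneg ε) (hu0 n)]
    · exact h0
  set c : ℕ → ℝ := fun n => (√(N n))⁻¹ with hc
  have hc2 : ∀ n, c n ^ 2 * N n = 1 := by
    intro n
    rw [hc, inv_pow, Real.sq_sqrt (hN0 n), inv_mul_cancel₀ (hNpos n).ne']
  have hψ := fun n => (hφ n).const_mul (c n)
  have hψ1 : ∀ n, ∫ y in (0 : ℝ)..L, (c n * φ n y) ^ 2 = 1 := by
    intro n
    simp_rw [mul_pow]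
    rw [intervalIntegral.integral_const_mul]; exact hc2 n
  have hscale : ∀ n, ∫ y in (0 : ℝ)..L, m y * (c n * φ n y) ^ 2 =
      c n ^ 2 * ∫ y in (0 : ℝ)..L, m y * φ n y ^ 2 := by
    intro n
    rw [← intervalIntegral.integral_const_mul]
    congr 1; funext y; ring
  have hscaled : ∀ n : ℕ, ε ^ 2 * (∫ y in (0 : ℝ)..L, (c n * u n y) ^ 2) +
      (∫ y in (0 : ℝ)..L, m y * (c n * φ n y) ^ 2) ≤ 1 / (n + 1) := by
    intro n
    have e1 : ∫ y in (0 : ℝ)..L, (c n * u n y) ^ 2 = c n ^ 2 * ∫ y in (0 : ℝ)..L, u n y ^ 2 := by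
      simp_rw [mul_pow]; rw [intervalIntegral.integral_const_mul]
    rw [e1, hscale]
    have h1 := mul_nonneg (sq_nonneg (c n)) (neg_nonneg.2 (hsplit n).le)
    have h2 : (1 : ℝ) / (n + 1) = 1 / (n + 1) * (c n ^ 2 * N n) := by rw [hc2, mul_one]
    rw [h2]; linarith
  have hmlow : ∀ n, -C ≤ ∫ y in (0 : ℝ)..L, m y * (c n * φ n y) ^ 2 := by
    intro n
    rw [hscale]
    have h1 := mul_le_mul_of_nonneg_left (hmN n) (sq_nonneg (c n))
    have h2 : C = C * (c n ^ 2 * N n) := by rw [hc2, mul_one]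
    linarith
  have hψu : ∀ n, ∫ y in (0 : ℝ)..L, (c n * u n y) ^ 2 ≤ (C + 1) / ε ^ 2 := by
    intro n
    rw [le_div_iff₀ (by positivity)]
    have h1 : (1 : ℝ) / (n + 1) ≤ 1 := by
      rw [div_le_one (by positivity)]; linarith [n.cast_nonneg (α := ℝ)]
    linarith [hscaled n, hmlow n]
  -- The Sobolev bound for the normalized functions controls their squares; the final `+ 1` comes
  -- from `|x| ≤ x² + 1`.
  set B : ℝ := (2 + 2 * L ^ 2 * ((C + 1) / ε ^ 2)) / L + 1 with hB
  have hψB : ∀ n, ∀ y ∈ Icc 0 L, |c n * φ n y| ≤ B := by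
    intro n y hy
    have h1 := (hψ n).sq_le hL.le hy
    rw [hψ1] at h1
    have h2 : (c n * φ n y) ^ 2 ≤ (2 + 2 * L ^ 2 * ((C + 1) / ε ^ 2)) / L := by
      rw [le_div_iff₀ hL]
      have := mul_le_mul_of_nonneg_left (hψu n) (by positivity : 0 ≤ 2 * L ^ 2)
      linarith
    have h3 : |c n * φ n y| ≤ (c n * φ n y) ^ 2 + 1 := by
      rw [← sq_abs]; nlinarith [sq_nonneg (|c n * φ n y| - 1), abs_nonneg (c n * φ n y)]
    linarith
  obtain ⟨σ, hσ, p, w, hp, hlim, hlsc⟩ := exists_subseq_memH1 (C := max B ((C + 1) / ε ^ 2)) hL.le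
    hψ (fun n => (hψB n 0 ⟨le_rfl, hL.le⟩).trans (le_max_left _ _))
    (fun n => (hψu n).trans (le_max_right _ _))
  have hB0 : 0 ≤ B := (abs_nonneg _).trans (hψB 0 0 ⟨le_rfl, hL.le⟩)
  have hψc : ∀ n, ContinuousOn (fun y => c n * φ n y) (Icc 0 L) := fun n => (hψ n).continuousOn hL.le
  have hsqB : ∀ n, ∀ y ∈ Icc 0 L, (c n * φ n y) ^ 2 ≤ B ^ 2 := fun n y hy => by
    rw [← sq_abs]; exact pow_le_pow_left₀ (abs_nonneg _) (hψB n y hy) 2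
  refine ⟨σ, hσ, fun n => c (σ n), B, p, w, hp, fun n => hψB (σ n), hlim, ?_, ?_⟩
  · have h1 := tendsto_integral_of_bounded (f := fun n y => (c (σ n) * φ (σ n) y) ^ 2)
      (F := fun y => p y ^ 2) (B := B ^ 2) hL.le (fun n => (hψc _).pow 2)
      (fun n y hy => by rw [abs_of_nonneg (sq_nonneg _)]; exact hsqB _ y hy)
      (fun y hy => (hlim y hy).pow 2)
    simp_rw [hψ1] at h1
    exact (tendsto_nhds_unique h1 tendsto_const_nhds)
  · have h1 := tendsto_integral_of_bounded (f := fun n y => m y * (c (σ n) * φ (σ n) y) ^ 2)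
      (F := fun y => m y * p y ^ 2) (B := C * B ^ 2) hL.le (fun n => hm.mul ((hψc _).pow 2))
      (fun n y hy => by
        rw [abs_mul, abs_of_nonneg (sq_nonneg (c (σ n) * φ (σ n) y))]
        exact mul_le_mul (hC y hy) (hsqB _ y hy) (sq_nonneg _) hC0)
      (fun y hy => ((hlim y hy).pow 2).const_mul _)
    have h2 : Tendsto (fun n => (1 : ℝ) / ((σ n : ℝ) + 1)) atTop (𝓝 0) :=
      tendsto_one_div_add_atTop_nhds_zero_nat.comp hσ.tendsto_atTop
    -- Only the second order term needs lower semicontinuity: it is bounded by a sequence that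
    -- converges, because the term with `m` passes to the limit by dominated convergence.
    have h3 := hlsc _ _ ((h2.sub h1).div_const (ε ^ 2)) (fun n => by
      rw [le_div_iff₀ (by positivity)]
      linarith [hscaled (σ n)])
    rw [le_div_iff₀ (by positivity)] at h3
    have h4 : IntervalIntegrable (fun y => m y * p y ^ 2) volume 0 L :=
      ci (hm.mul ((hp.continuousOn hL.le).pow 2))
    rw [intervalIntegral.integral_add ((MemLp.intervalIntegrable_sq hL.le hp.memLp).const_mul _) h4,
      intervalIntegral.integral_const_mul]
    linarith

/-- A competitor for `h'` cut off to `[a,b]`, at distance at most `e`, with lower energy, and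
orthogonal to the translation mode if there is one. -/
structure IsCompetitor (W : ℝ → ℝ) (ε L : ℝ) (h : ℝ → ℝ) (a b e : ℝ) (q z : ℝ → ℝ) : Prop where
  memH1 : MemH1 L q z
  nonneg : ∀ y ∈ Icc 0 L, 0 ≤ q y
  integral_eq : ∫ y in (0 : ℝ)..L, q y = ∫ y in (0 : ℝ)..L, cutGrad L h a b y
  off : ∀ y ∈ Icc 0 L, y ∉ Icc a b → y ∈ broken L h ∨ (q y = 0 ∧ z y = 0)
  close : ∀ y ∈ Icc 0 L, |q y - cutGrad L h a b y| ≤ e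
  support : ∀ y ∈ Icc 0 L, y ∉ Icc (a - e) (b + e) → q y = 0
  energy_lt : ∫ y in (0 : ℝ)..L, density W ε q z y <
    ∫ y in (0 : ℝ)..L, density W ε (cutGrad L h a b) (cutHess L h a b) y
  orthogonal : a ∈ crackFaces L h → b ∈ crackFaces L h →
    ∫ y in (0 : ℝ)..L, (∫ t in (0 : ℝ)..y, (q t - cutGrad L h a b t)) * cutGrad L h a b y = 0

/-- The second variation is positive on the restricted variations orthogonal to all translation
modes. -/
def PositiveModuloTranslations (W : ℝ → ℝ) (ε L : ℝ) (h : ℝ → ℝ) : Prop :=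
  ∀ η ∈ restrictedVariations L h, (∃ y ∈ Icc 0 L, η y ≠ 0) →
    (∀ r s, IsUnbrokenPart L h r s →
      ∫ y in (0 : ℝ)..L, η y * translationMode L h r s y = 0) →
    0 < secondVariation W ε L h η

section limit

variable {W : ℝ → ℝ} {ε L : ℝ} {h : ℝ → ℝ} {a b : ℝ}

lemma left_mem_crackFaces (hab : a < b) (hg : Ioo a b ⊆ good L h) (ha : a ∈ broken L h) :
    a ∈ crackFaces L h := by
  refine ⟨ha, fun ⟨α, hα, hB⟩ => ?_⟩
  obtain ⟨t, ht, ht'⟩ := exists_between (lt_min hab (show a < a + α by linarith))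
  have htg := hg ⟨ht, ht'.trans_le (min_le_left _ _)⟩
  exact htg.2 (hB ⟨⟨by linarith, (ht'.trans_le (min_le_right _ _)).le⟩, htg.1⟩)

lemma right_mem_crackFaces (hab : a < b) (hg : Ioo a b ⊆ good L h) (hb : b ∈ broken L h) :
    b ∈ crackFaces L h := by
  refine ⟨hb, fun ⟨α, hα, hB⟩ => ?_⟩
  obtain ⟨t, ht, ht'⟩ := exists_between (max_lt hab (show b - α < b by linarith))
  have htg := hg ⟨(le_max_left _ _).trans_lt ht, ht'⟩
  exact htg.2 (hB ⟨⟨((le_max_right _ _).trans_lt ht).le, by linarith⟩, htg.1⟩)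

lemma cutGrad_memH1 (hL : 0 < L) {g : ℝ → ℝ} (hg : MemH2 L g) (ha0 : 0 ≤ a) (hab : a < b)
    (hbL : b ≤ L) (ha : a = 0 ∨ D L g a = 0) (hb : b = L ∨ D L g b = 0) :
    MemH1 L (cutGrad L g a b) (cutHess L g a b) :=
  (hg.memH1 hL).indicator hL.le ha0 hab.le hbL ha hb

/-- An element of `H¹` supported in `[a,b]` with zero mean and nonpositive second variation, which
is orthogonal to the translation mode of `(a,b)`, contradicts positivity. -/
lemma false_of_form_nonpos (hL : 0 < L) (hnd : NondegenerateCracks L h)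
    (hpos : PositiveModuloTranslations W ε L h) (ha0 : 0 ≤ a) (hab : a < b) (hbL : b ≤ L)
    (ha : a = 0 ∨ a ∈ crackFaces L h) (hb : b = L ∨ b ∈ crackFaces L h)
    (hg : Ioo a b ⊆ good L h) {p w : ℝ → ℝ} (hp : MemH1 L p w)
    (hsupp : ∀ y ∈ Icc 0 L, y ∉ Icc a b → p y = 0) (hint : ∫ y in (0 : ℝ)..L, p y = 0)
    (hone : ∫ y in (0 : ℝ)..L, p y ^ 2 = 1)
    (horth : a ∈ crackFaces L h → b ∈ crackFaces L h →
      ∫ y in (0 : ℝ)..L, (∫ t in (0 : ℝ)..y, p t) * cutGrad L h a b y = 0)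
    (hform : ∫ y in (0 : ℝ)..L,
      (ε ^ 2 * w y ^ 2 + Mstar W (cutGrad L h a b y) * p y ^ 2) ≤ 0) : False := by
  have hpc := hp.continuousOn hL.le
  have hpi : ∀ x ∈ Icc 0 L, ∀ y ∈ Icc 0 L, IntervalIntegrable p volume x y := by
    intro x hx y hy
    apply ContinuousOn.intervalIntegrable
    rw [← uIcc_of_le hL.le] at hpc hx hy
    exact hpc.mono (uIcc_subset_uIcc hx hy)
  set η : ℝ → ℝ := fun y => ∫ t in (0 : ℝ)..y, p t with hη
  have hleft : ∀ y ∈ Icc 0 L, y ≤ a → η y = 0 := by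
    intro y hy hya
    rw [hη]; beta_reduce
    rw [intervalIntegral.integral_of_le hy.1, integral_Ioc_eq_integral_Ioo]
    exact setIntegral_eq_zero_of_forall_eq_zero fun t ht =>
      hsupp t ⟨ht.1.le, ht.2.le.trans hy.2⟩ fun h => by linarith [h.1, ht.2]
  have hright : ∀ y ∈ Icc 0 L, b ≤ y → η y = 0 := by
    intro y hy hyb
    have h1 := intervalIntegral.integral_add_adjacent_intervals
      (hpi 0 ⟨le_rfl, hL.le⟩ y hy) (hpi y hy L ⟨hL.le, le_rfl⟩)
    have h2 : ∫ t in y..L, p t = 0 := by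
      rw [intervalIntegral.integral_of_le hy.2]
      exact setIntegral_eq_zero_of_forall_eq_zero fun t ht =>
        hsupp t ⟨hy.1.trans ht.1.le, ht.2⟩ fun h => by linarith [h.2, ht.1]
    rw [hint, h2, add_zero] at h1
    exact h1
  -- By continuity `p` vanishes also at `a`. This fails to be forced when `a = 0`, but then `a` is
  -- not broken and no condition is required there.
  have hp_left : 0 < a → ∀ y ∈ Icc 0 a, p y = 0 := by
    intro h0
    have h1 : EqOn p (fun _ => 0) (Ico 0 a) := fun y hy =>
      hsupp y ⟨hy.1, by linarith [hy.2]⟩ fun h => by linarith [h.1, hy.2]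
    exact h1.of_subset_closure (hpc.mono (Icc_subset_Icc le_rfl (by linarith))) continuousOn_const
      Ico_subset_Icc_self (closure_Ico h0.ne).ge
  have hp_right : b < L → ∀ y ∈ Icc b L, p y = 0 := by
    intro h0
    have h1 : EqOn p (fun _ => 0) (Ioc b L) := fun y hy =>
      hsupp y ⟨by linarith [hy.1], hy.2⟩ fun h => by linarith [h.2, hy.1]
    exact h1.of_subset_closure (hpc.mono (Icc_subset_Icc (by linarith) le_rfl)) continuousOn_const
      Ioc_subset_Icc_self (closure_Ioc h0.ne).ge
  -- A broken end of the unbroken interval is a crack face, and crack faces lie strictly inside the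
  -- bar; so a broken end is never `0` or `L`.
  have hbroken : ∀ y ∈ broken L h, (y ≤ a ∧ 0 < a) ∨ (b ≤ y ∧ b < L) := by
    intro y hy
    rcases le_or_gt y a with hya | hya
    · left
      refine ⟨hya, ha0.lt_of_ne fun h0 => ?_⟩
      have hya' : y = a := le_antisymm hya (h0 ▸ hy.1.1)
      have := crackFaces_subset_Ioo hnd (left_mem_crackFaces hab hg (hya' ▸ hy))
      exact absurd this.1 (by rw [← h0]; exact lt_irrefl _)
    · right
      have hby : b ≤ y := le_of_not_gt fun hyb => (hg ⟨hya, hyb⟩).2 hy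
      refine ⟨hby, hbL.lt_of_ne fun h0 => ?_⟩
      have hyb' : y = b := le_antisymm (h0 ▸ hy.1.2) hby
      have := crackFaces_subset_Ioo hnd (right_mem_crackFaces hab hg (hyb' ▸ hy))
      exact absurd this.2 (by rw [← h0]; exact lt_irrefl _)
  have hDη : ∀ y ∈ Icc 0 L, D L η y = p y := fun y hy => D_primitive hL hpc hy
  have hDB : ∀ y ∈ broken L h, D L η y = 0 := by
    intro y hy
    rw [hDη y hy.1]
    rcases hbroken y hy with ⟨h1, h2⟩ | ⟨h1, h2⟩
    · exact hp_left h2 y ⟨hy.1.1, h1⟩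
    · exact hp_right h2 y ⟨h1, hy.1.2⟩
  have hηB : ∀ y ∈ broken L h, η y = 0 := by
    intro y hy
    rcases hbroken y hy with ⟨h1, -⟩ | ⟨h1, -⟩
    · exact hleft y hy.1 h1
    · exact hright y hy.1 h1
  have hmem : η ∈ restrictedVariations L h :=
    ⟨⟨⟨memH2_primitive hL hp, by simp [hη], hint⟩, fun y hy => (hDB y hy).ge,
      fun y hy => hηB y hy.1⟩, hDB, hηB⟩
  have hne : ∃ y ∈ Icc 0 L, η y ≠ 0 := by
    by_contra! hno
    have h1 : ∀ y ∈ uIcc 0 L, p y ^ 2 = (fun _ => (0 : ℝ)) y := by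
      intro y hy
      rw [uIcc_of_le hL.le] at hy
      have h2 : D L η y = D L (fun _ => 0) y := D_congr hno hy
      rw [hDη y hy] at h2
      simp [h2, D]
    rw [intervalIntegral.integral_congr h1] at hone
    simp at hone
  have horth' : ∀ r s, IsUnbrokenPart L h r s →
      ∫ y in (0 : ℝ)..L, η y * translationMode L h r s y = 0 := by
    intro r s hrs
    -- Two different unbroken intervals of this kind are disjoint, so orthogonality is a genuine
    -- condition only for the mode of `(a,b)` itself.
    by_cases heq : r = a ∧ s = b
    · obtain ⟨rfl, rfl⟩ := heq
      rw [translationMode_eq_cutGrad hrs]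
      exact horth hrs.1 hrs.2.1
    · have h1 : ∀ y ∈ uIcc 0 L, η y * translationMode L h r s y = (fun _ => (0 : ℝ)) y := by
        intro y hy
        rw [uIcc_of_le hL.le] at hy
        by_cases hyrs : y ∈ Ioo r s
        · have hη0 : η y = 0 := by
            rcases le_or_gt y a with hya | hya
            · exact hleft y hy hya
            rcases le_or_gt b y with hyb | hyb
            · exact hright y hy hyb
            exfalso
            apply heq
            constructor
            · apply le_antisymm
              · by_contra hlt
                exact (hg ⟨lt_of_not_ge hlt, hyrs.1.trans hyb⟩).2 hrs.1.1
              · by_contra hlt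
                rcases ha with rfl | ha
                · exact hlt hrs.1.1.1.1
                · exact (hrs.2.2.2 ⟨lt_of_not_ge hlt, hya.trans hyrs.2⟩).2 ha.1
            · apply le_antisymm
              · by_contra hlt
                rcases hb with rfl | hb
                · exact hlt hrs.2.1.1.1.2
                · exact (hrs.2.2.2 ⟨hyrs.1.trans hyb, lt_of_not_ge hlt⟩).2 hb.1
              · by_contra hlt
                exact (hg ⟨hya.trans hyrs.2, lt_of_not_ge hlt⟩).2 hrs.2.1.1
          rw [hη0, zero_mul]
        · rw [translationMode, indicator_of_notMem hyrs, mul_zero]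
      rw [intervalIntegral.integral_congr h1]; simp
  have hlt := hpos η hmem hne horth'
  refine absurd hform (not_le.2 (hlt.trans_eq ?_))
  rw [secondVariation, intervalIntegral_eq_restrict hL.le, intervalIntegral_eq_restrict hL.le]
  apply integral_congr_ae
  filter_upwards [D_D_primitive hL hp, ae_restrict_mem measurableSet_Icc] with y hyD hy
  rw [hyD, hDη y hy]
  by_cases hyab : y ∈ Icc a b
  · rw [cutGrad, indicator_of_mem hyab]
  · rw [hsupp y hy hyab]; ring

/-- Under positivity of the second variation there are no competitors close to `h`. -/
lemma exists_no_competitor (hW : ContDiffOn ℝ 2 (Wstar W) (Ici 0)) (hε : 0 < ε) (hL : 0 < L)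
    (hK : h ∈ K L) (hEL : SolvesEL W ε L h) (hnd : NondegenerateCracks L h)
    (hpos : PositiveModuloTranslations W ε L h) (ha0 : 0 ≤ a) (hab : a < b) (hbL : b ≤ L)
    (ha : a = 0 ∨ a ∈ crackFaces L h) (hb : b = L ∨ b ∈ crackFaces L h)
    (hg : Ioo a b ⊆ good L h) : ∃ e > 0, ∀ q z, ¬ IsCompetitor W ε L h a b e q z := by
  by_contra! hcomp
  have hB := ae_D_D_eq_zero hL hK hnd
  have hP : MemH1 L (cutGrad L h a b) (cutHess L h a b) :=
    cutGrad_memH1 hL hK.1 ha0 hab hbL (ha.imp_right fun h => h.1.2) (hb.imp_right fun h => h.1.2)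
  obtain ⟨R, hR0, hR⟩ := exists_bound_D hL hK.1
  obtain ⟨C, hC0, hC⟩ := exists_bound_Mstar hW R
  have hmem := cutGrad_mem_Icc hK.2.2.2 hR0 hR ha0 hbL
  set P := cutGrad L h a b with hPdef
  have hPc := hP.continuousOn hL.le
  have hMc : ContinuousOn (Mstar W) (Icc 0 (R + 1)) := (continuousOn_Mstar hW).mono fun t ht => ht.1
  have hunif := Metric.uniformContinuousOn_iff.1
    (isCompact_Icc.uniformContinuousOn_of_continuous hMc)
  -- The distance `e` is at most `1/(n+1)`, and small enough that uniform continuity of M* on `[0,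
  -- R+1]` costs at most `1/(n+1)` between `P` and `q`; the interval suffices because `e ≤ 1`.
  have hseq : ∀ n : ℕ, ∃ (e : ℝ) (q z : ℝ → ℝ), 0 < e ∧ e ≤ 1 / (n + 1) ∧ IsCompetitor W ε L h a b e q z ∧
      ∀ y ∈ Icc 0 L, ∀ t ∈ uIcc (P y) (q y), Mstar W (P y) - 1 / (n + 1) ≤ Mstar W t := by
    intro n
    obtain ⟨δ, hδ, hM⟩ := hunif (1 / (n + 1)) (by positivity)
    have hn1 : (1 : ℝ) / (n + 1) ≤ 1 := by
      rw [div_le_one (by positivity)]; linarith [n.cast_nonneg (α := ℝ)]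
    set e := min (δ / 2) (1 / ((n : ℝ) + 1)) with he
    have he0 : 0 < e := lt_min (by linarith) (by positivity)
    have he1 : e ≤ 1 / ((n : ℝ) + 1) := min_le_right _ _
    have he2 : e ≤ δ / 2 := min_le_left _ _
    obtain ⟨q, z, hqz⟩ := hcomp e he0
    refine ⟨e, q, z, he0, he1, hqz, fun y hy t ht => ?_⟩
    have hq := abs_le.1 (hqz.close y hy)
    have hPy := hmem y
    have hqI : q y ∈ Icc 0 (R + 1) := ⟨hqz.nonneg y hy, by linarith [hPy.2, hq.2]⟩
    have hPI : P y ∈ Icc 0 (R + 1) := ⟨hPy.1, by linarith [hPy.2]⟩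
    have htI := ordConnected_Icc.uIcc_subset hPI hqI ht
    have hdist : dist (P y) t < δ := by
      rw [dist_comm, Real.dist_eq]
      have := abs_sub_left_of_mem_uIcc ht
      linarith [hqz.close y hy]
    have := hM (P y) hPI t htI hdist
    rw [Real.dist_eq] at this
    linarith [(abs_lt.1 this).2]
  choose e q z he0 he1 hqz hM using hseq
  have hMP : ContinuousOn (fun y => Mstar W (P y)) (Icc 0 L) :=
    (continuousOn_Mstar hW).comp hPc fun y _ => (hmem y).1
  obtain ⟨σ, hσ, c, B, p, w, hp, hbd, hlim, hone, hform⟩ := exists_limit_of_form_neg hL hε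
    -- Lower energy together with the comparison inequality makes the perturbed form strictly
    -- negative on `q - P`.
    hMP (fun y _ => hC _ (hmem y)) (fun n => (hqz n).memH1.sub hL.le hP) (fun n => by
      have h1 := energy_comparison hW hL hK hEL hB hP (hqz n).memH1 (hqz n).nonneg
        (hqz n).integral_eq (hqz n).off (m := fun y => Mstar W (P y) - 1 / (n + 1))
        (hMP.sub continuousOn_const) (hM n)
      linarith [(hqz n).energy_lt])
  have hφc : ∀ n, ContinuousOn (fun y => q n y - P y) (Icc 0 L) := fun n =>
    ((hqz n).memH1.continuousOn hL.le).sub hPc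
  have hψc : ∀ n, ContinuousOn (fun y => c n * (q (σ n) y - P y)) (Icc 0 L) := fun n =>
    continuousOn_const.mul (hφc _)
  have hprim : ∀ y ∈ Icc 0 L, Tendsto (fun n => ∫ t in (0 : ℝ)..y, c n * (q (σ n) t - P t)) atTop
      (𝓝 (∫ t in (0 : ℝ)..y, p t)) := by
    intro y hy
    have hsub : Icc 0 y ⊆ Icc 0 L := Icc_subset_Icc_right hy.2
    exact tendsto_integral_of_bounded hy.1 (fun n => (hψc n).mono hsub)
      (fun n t ht => hbd n t (hsub ht)) (fun t ht => hlim t (hsub ht))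
  have hlim0 : Tendsto (fun n => e (σ n)) atTop (𝓝 0) := by
    refine squeeze_zero (fun n => (he0 _).le) (fun n => he1 _) ?_
    exact tendsto_one_div_add_atTop_nhds_zero_nat.comp hσ.tendsto_atTop
  refine false_of_form_nonpos hL hnd hpos ha0 hab hbL ha hb hg hp ?_ ?_ hone ?_ hform
  · intro y hy hyab
    have hP0 : P y = 0 := indicator_of_notMem hyab _
    -- The competitors may protrude from `[a,b]` by `e`, which tends to zero, so the limit is
    -- supported in `[a,b]`.
    have hev : ∀ᶠ n in atTop, y ∉ Icc (a - e (σ n)) (b + e (σ n)) := by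
      rcases lt_or_ge y a with hya | hya
      · filter_upwards [hlim0.eventually_lt_const (sub_pos.2 hya)] with n hn hm
        linarith [hm.1]
      · have hyb : b < y := lt_of_not_ge fun h2 => hyab ⟨hya, h2⟩
        filter_upwards [hlim0.eventually_lt_const (sub_pos.2 hyb)] with n hn hm
        linarith [hm.2]
    refine tendsto_nhds_unique (hlim y hy) (tendsto_const_nhds.congr' ?_)
    filter_upwards [hev] with n hn
    rw [(hqz (σ n)).support y hy hn, hP0]; ring
  · have h1 := hprim L ⟨hL.le, le_rfl⟩
    have h2 : ∀ n, ∫ t in (0 : ℝ)..L, c n * (q (σ n) t - P t) = 0 := by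
      intro n
      have i1 : IntervalIntegrable (q (σ n)) volume 0 L := by
        apply ContinuousOn.intervalIntegrable; rw [uIcc_of_le hL.le]
        exact (hqz _).memH1.continuousOn hL.le
      have i2 : IntervalIntegrable P volume 0 L := by
        apply ContinuousOn.intervalIntegrable; rwa [uIcc_of_le hL.le]
      rw [intervalIntegral.integral_const_mul, intervalIntegral.integral_sub i1 i2,
        (hqz _).integral_eq, sub_self, mul_zero]
    simp_rw [h2] at h1
    exact tendsto_nhds_unique h1 tendsto_const_nhds
  · intro haC hbC
    have h1 : Tendsto (fun n => ∫ y in (0 : ℝ)..L,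
        (∫ t in (0 : ℝ)..y, c n * (q (σ n) t - P t)) * P y) atTop
        (𝓝 (∫ y in (0 : ℝ)..L, (∫ t in (0 : ℝ)..y, p t) * P y)) := by
      apply tendsto_integral_of_bounded (B := (B * L) * R) hL.le
      · intro n
        refine ContinuousOn.mul (fun y hy => ?_) hPc
        exact (hasDerivWithinAt_primitive hL (hψc n) hy).continuousWithinAt
      · intro n y hy
        have hB0 : 0 ≤ B := (abs_nonneg _).trans (hbd n y hy)
        have h2 : ‖∫ t in (0 : ℝ)..y, c n * (q (σ n) t - P t)‖ ≤ B * |y - 0| := by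
          apply intervalIntegral.norm_integral_le_of_norm_le_const
          intro t ht
          rw [uIoc_of_le hy.1] at ht
          exact hbd n t ⟨ht.1.le, ht.2.trans hy.2⟩
        rw [Real.norm_eq_abs, sub_zero, abs_of_nonneg hy.1] at h2
        rw [abs_mul, abs_of_nonneg (hmem y).1]
        exact mul_le_mul (h2.trans (mul_le_mul_of_nonneg_left hy.2 hB0)) (hmem y).2 (hmem y).1
          (mul_nonneg hB0 hL.le)
      · intro y hy
        exact (hprim y hy).mul_const _
    have h2 : ∀ n, ∫ y in (0 : ℝ)..L, (∫ t in (0 : ℝ)..y, c n * (q (σ n) t - P t)) * P y = 0 := by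
      intro n
      have h3 := (hqz (σ n)).orthogonal haC hbC
      simp_rw [intervalIntegral.integral_const_mul, mul_assoc]
      rw [intervalIntegral.integral_const_mul, h3, mul_zero]
    simp_rw [h2] at h1
    exact tendsto_nhds_unique h1 tendsto_const_nhds

end limit

/-! ### Choice of the translate -/

/-- A small perturbation `Q` of a nonnegative function `P` supported in `[a,b]` can be translated
so that the primitive of the difference is orthogonal to `P`. -/
lemma exists_shift_orthogonal {P : ℝ → ℝ} {a b L ρ : ℝ} (hP : Continuous P) (hP0 : ∀ y, 0 ≤ P y)
    (hsupp : ∀ y, y ∉ Ioo a b → P y = 0) (hpos : ∀ y ∈ Ioo a b, 0 < P y) (hab : a < b)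
    (hρ : 0 < ρ) (hρa : ρ ≤ a) (hbL : b ≤ L) :
    ∃ s > 0, ∀ Q : ℝ → ℝ, Continuous Q → (∀ y, |Q y - P y| ≤ s) → ∃ τ, |τ| ≤ ρ ∧
      ∫ y in (0 : ℝ)..L, (∫ t in (0 : ℝ)..y, (Q (t + τ) - P t)) * P y = 0 := by
  have hL : 0 < L := by linarith
  set Φ : (ℝ → ℝ) → ℝ → ℝ := fun Q τ =>
    ∫ y in (0 : ℝ)..L, (∫ t in (0 : ℝ)..y, (Q (t + τ) - P t)) * P y with hΦ
  have hinner : ∀ Q : ℝ → ℝ, Continuous Q → ∀ τ y, ∫ t in (0 : ℝ)..y, (Q (t + τ) - P t) =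
      (∫ t in τ..(y + τ), Q t) - ∫ t in (0 : ℝ)..y, P t := by
    intro Q hQ τ y
    rw [intervalIntegral.integral_sub (Continuous.intervalIntegrable (by fun_prop) _ _)
      (hP.intervalIntegrable _ _), intervalIntegral.integral_comp_add_right Q, zero_add]
  have hprim : ∀ Q : ℝ → ℝ, Continuous Q → Continuous fun y => ∫ t in (0 : ℝ)..y, Q t :=
    fun Q hQ => intervalIntegral.continuous_primitive (fun c d => hQ.intervalIntegrable c d) 0
  have hinner' : ∀ Q : ℝ → ℝ, Continuous Q → ∀ τ y, ∫ t in (0 : ℝ)..y, (Q (t + τ) - P t) =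
      (∫ t in (0 : ℝ)..(y + τ), Q t) - (∫ t in (0 : ℝ)..τ, Q t) - ∫ t in (0 : ℝ)..y, P t := by
    intro Q hQ τ y
    rw [hinner Q hQ, intervalIntegral.integral_interval_sub_left (hQ.intervalIntegrable _ _)
      (hQ.intervalIntegrable _ _)]
  have hjoint : ∀ Q : ℝ → ℝ, Continuous Q → Continuous (Function.uncurry fun τ y =>
      (∫ t in (0 : ℝ)..y, (Q (t + τ) - P t)) * P y) := by
    intro Q hQ
    have h1 := hprim Q hQ
    have h2 := hprim P hP
    simp_rw [hinner' Q hQ]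
    have h3 : Continuous fun x : ℝ × ℝ => ∫ t in (0 : ℝ)..(x.2 + x.1), Q t :=
      h1.comp (continuous_snd.add continuous_fst)
    have h4 : Continuous fun x : ℝ × ℝ => ∫ t in (0 : ℝ)..x.1, Q t := h1.comp continuous_fst
    have h5 : Continuous fun x : ℝ × ℝ => ∫ t in (0 : ℝ)..x.2, P t := h2.comp continuous_snd
    exact ((h3.sub h4).sub h5).mul (hP.comp continuous_snd)
  have hslice : ∀ Q : ℝ → ℝ, Continuous Q → ∀ τ, Continuous fun y =>
      (∫ t in (0 : ℝ)..y, (Q (t + τ) - P t)) * P y := fun Q hQ τ =>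
    (hjoint Q hQ).comp (Continuous.prodMk_right τ)
  have hΦc : ∀ Q : ℝ → ℝ, Continuous Q → Continuous (Φ Q) := fun Q hQ =>
    intervalIntegral.continuous_parametric_intervalIntegral_of_continuous' (hjoint Q hQ) 0 L
  have hzero : ∀ c d, c ≤ d → (∀ t ∈ Ioo c d, t ∉ Ioo a b) → ∫ t in c..d, P t = 0 := by
    intro c d hcd hno
    rw [intervalIntegral.integral_of_le hcd, integral_Ioc_eq_integral_Ioo]
    exact setIntegral_eq_zero_of_forall_eq_zero fun t ht => hsupp t (hno t ht)
  set x := (a + b) / 2 with hx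
  have hxab : x ∈ Ioo a b := ⟨by rw [hx]; linarith, by rw [hx]; linarith⟩
  have hxL : x ∈ Icc 0 L := ⟨by linarith [hxab.1], by linarith [hxab.2]⟩
  -- For `Q = P` the inner integral is the integral of `P` over `[y, y+ρ]`, because `ρ ≤ a` makes
  -- `P` vanish on `[0,ρ]`. So `Φ` is positive at `ρ`, and by the mirrored argument negative at
  -- `-ρ`.
  have hplus : 0 < Φ P ρ := by
    have hin : ∀ y, ∫ t in (0 : ℝ)..y, (P (t + ρ) - P t) = ∫ t in y..(y + ρ), P t := by
      intro y
      rw [hinner' P hP, hzero 0 ρ hρ.le fun t ht h => by linarith [h.1, ht.2], sub_zero,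
        intervalIntegral.integral_interval_sub_left (hP.intervalIntegrable _ _)
          (hP.intervalIntegrable _ _)]
    apply intervalIntegral.integral_pos hL (hslice P hP ρ).continuousOn
    · intro y _
      rw [hin]
      exact mul_nonneg (intervalIntegral.integral_nonneg (by linarith) fun t _ => hP0 t) (hP0 y)
    · refine ⟨x, hxL, ?_⟩
      rw [hin]
      exact mul_pos (intervalIntegral.integral_pos (by linarith) hP.continuousOn
        (fun t _ => hP0 t) ⟨x, ⟨le_rfl, by linarith⟩, hpos x hxab⟩) (hpos x hxab)
  have hminus : 0 < -Φ P (-ρ) := by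
    have hin : ∀ y, ∫ t in (0 : ℝ)..y, (P (t + -ρ) - P t) = -∫ t in (y - ρ)..y, P t := by
      intro y
      have h0 : ∫ t in (0 : ℝ)..(-ρ), P t = 0 := by
        rw [intervalIntegral.integral_symm,
          hzero (-ρ) 0 (by linarith) fun t ht h => by linarith [h.1, ht.2], neg_zero]
      rw [hinner' P hP, h0, sub_zero, intervalIntegral.integral_interval_sub_left
          (hP.intervalIntegrable _ _) (hP.intervalIntegrable _ _), intervalIntegral.integral_symm,
          ← sub_eq_add_neg]
    rw [hΦ, ← intervalIntegral.integral_neg]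
    apply intervalIntegral.integral_pos hL (hslice P hP (-ρ)).neg.continuousOn
    · intro y _
      rw [Pi.neg_apply, hin, neg_mul, neg_neg]
      exact mul_nonneg (intervalIntegral.integral_nonneg (by linarith) fun t _ => hP0 t) (hP0 y)
    · refine ⟨x, hxL, ?_⟩
      rw [Pi.neg_apply, hin, neg_mul, neg_neg]
      exact mul_pos (intervalIntegral.integral_pos (by linarith) hP.continuousOn
        (fun t _ => hP0 t) ⟨x, ⟨by linarith, le_rfl⟩, hpos x hxab⟩) (hpos x hxab)
  obtain ⟨R, hR⟩ := (isCompact_Icc (a := (0 : ℝ)) (b := L)).bddAbove_image hP.continuousOn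
  have hR' : ∀ y ∈ Icc 0 L, P y ≤ R := fun y hy => hR (mem_image_of_mem _ hy)
  have hR0 : 0 ≤ R := (hP0 x).trans (hR' x hxL)
  set κ := min (Φ P ρ) (-Φ P (-ρ)) with hκ
  have hκ0 : 0 < κ := lt_min hplus hminus
  -- Perturbing `P` by at most `s` moves `Φ` by at most `s L² R ≤ κ`, uniformly in `τ`; the signs at
  -- `±ρ` survive weakly and the intermediate value theorem applies.
  refine ⟨κ / (L * L * R + 1), by positivity, fun Q hQ hQP => ?_⟩
  set s := κ / (L * L * R + 1) with hs
  have hs0 : 0 < s := by positivity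
  have hdiff : ∀ τ, |Φ Q τ - Φ P τ| ≤ κ := by
    intro τ
    rw [hΦ, ← intervalIntegral.integral_sub ((hslice Q hQ τ).intervalIntegrable _ _)
      ((hslice P hP τ).intervalIntegrable _ _)]
    have h1 := intervalIntegral.norm_integral_le_of_norm_le_const (a := 0) (b := L)
      (C := s * L * R) (f := fun y => (∫ t in (0 : ℝ)..y, (Q (t + τ) - P t)) * P y -
        (∫ t in (0 : ℝ)..y, (P (t + τ) - P t)) * P y) (fun y hy => by
        rw [uIoc_of_le hL.le] at hy
        rw [← sub_mul, ← intervalIntegral.integral_sub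
          (Continuous.intervalIntegrable (by fun_prop) _ _)
          (Continuous.intervalIntegrable (by fun_prop) _ _), norm_mul]
        have h2 : ‖∫ t in (0 : ℝ)..y, (Q (t + τ) - P t - (P (t + τ) - P t))‖ ≤ s * |y - 0| := by
          apply intervalIntegral.norm_integral_le_of_norm_le_const
          intro t _
          rw [sub_sub_sub_cancel_right]
          exact hQP _
        rw [sub_zero, abs_of_pos hy.1] at h2
        rw [Real.norm_of_nonneg (hP0 y)]
        exact mul_le_mul (h2.trans (mul_le_mul_of_nonneg_left hy.2 hs0.le))
          (hR' y ⟨hy.1.le, hy.2⟩) (hP0 y) (by positivity))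
    rw [sub_zero, abs_of_pos hL] at h1
    refine h1.trans ?_
    have h3 : s * (L * L * R + 1) = κ := by rw [hs]; field_simp
    nlinarith
  have h1 : 0 ≤ Φ Q ρ := by
    have := (abs_le.1 (hdiff ρ)).1
    linarith [min_le_left (Φ P ρ) (-Φ P (-ρ))]
  have h2 : Φ Q (-ρ) ≤ 0 := by
    have := (abs_le.1 (hdiff (-ρ))).2
    linarith [min_le_right (Φ P ρ) (-Φ P (-ρ))]
  obtain ⟨τ, hτ, hτ0⟩ := intermediate_value_Icc (by linarith : -ρ ≤ ρ) (hΦc Q hQ).continuousOn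
    ⟨h2, h1⟩
  exact ⟨τ, abs_le.2 hτ, hτ0⟩

/-! ### Local minimality on each interval and summation -/

/-- The embedding of `H²(0,L)` into `C¹([0,L])`. -/
lemma exists_D_le_H2norm {L : ℝ} (hL : 0 < L) :
    ∃ κ > 0, ∀ η, MemH2 L η → ∀ y ∈ Icc 0 L, |D L η y| ≤ κ * H2norm L η := by
  refine ⟨√((2 + 2 * L ^ 2) / L), by positivity, fun η hη y hy => ?_⟩
  have h1 := hη.memH1 hL
  have i0 : IntervalIntegrable (fun y => η y ^ 2) volume 0 L := by
    apply ContinuousOn.intervalIntegrable; rw [uIcc_of_le hL.le]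
    exact hη.differentiableOn.continuousOn.pow 2
  have i1 := h1.intervalIntegrable_sq_left hL.le
  have i2 := MemLp.intervalIntegrable_sq hL.le h1.memLp
  have n0 : 0 ≤ ∫ y in (0 : ℝ)..L, η y ^ 2 :=
    intervalIntegral.integral_nonneg hL.le fun _ _ => sq_nonneg _
  have n1 : 0 ≤ ∫ y in (0 : ℝ)..L, D L η y ^ 2 :=
    intervalIntegral.integral_nonneg hL.le fun _ _ => sq_nonneg _
  have n2 : 0 ≤ ∫ y in (0 : ℝ)..L, D L (D L η) y ^ 2 :=
    intervalIntegral.integral_nonneg hL.le fun _ _ => sq_nonneg _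
  rw [H2norm, ← Real.sqrt_mul (by positivity)]
  apply Real.abs_le_sqrt
  rw [intervalIntegral.integral_add (i0.add i1) i2, intervalIntegral.integral_add i0 i1,
    div_mul_eq_mul_div, le_div_iff₀ hL]
  have h2 := h1.sq_le hL.le hy
  nlinarith [mul_nonneg (sq_nonneg L) n0, mul_nonneg (sq_nonneg L) n1]

section gap

variable {W : ℝ → ℝ} {ε L : ℝ} {h g : ℝ → ℝ} {a b : ℝ}

lemma D_sub_eq (hg : MemH2 L g) (hh : MemH2 L h) {y : ℝ} (hy : y ∈ Icc 0 L) :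
    D L (g - h) y = D L g y - D L h y :=
  derivWithin_sub (hg.differentiableOn y hy) (hh.differentiableOn y hy)

/-- The variation vanishes at both ends of the interval, so each interval carries its own integral
constraint. -/
lemma integral_D_eq (hL : 0 < L) (hg : g ∈ K L) (hK : h ∈ K L)
    (hη : g - h ∈ admissibleVariations L h) (ha0 : 0 ≤ a) (hab : a < b) (hbL : b ≤ L)
    (ha : a = 0 ∨ a ∈ crackFaces L h) (hb : b = L ∨ b ∈ crackFaces L h) :
    ∫ y in a..b, D L g y = ∫ y in a..b, D L h y := by
  have hmema : a ∈ Icc 0 L := ⟨ha0, hab.le.trans hbL⟩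
  have hmemb : b ∈ Icc 0 L := ⟨ha0.trans hab.le, hbL⟩
  rw [← hg.1.sub_eq_integral hL hmema hmemb, ← hK.1.sub_eq_integral hL hmema hmemb]
  have h1 : (g - h) a = 0 := by
    rcases ha with rfl | ha
    · exact hη.1.2.1
    · exact hη.2.2 a ha
  have h2 : (g - h) b = 0 := by
    rcases hb with rfl | hb
    · exact hη.1.2.2
    · exact hη.2.2 b hb
  rw [Pi.sub_apply] at h1 h2
  linarith

/-- Both `h'` and the slope of the variation vanish at a crack face. This is what keeps the cut-off
of `g'` in H¹. -/
lemma D_eq_zero_of_crackFace (hL : 0 < L) (hK : h ∈ K L) (hnd : NondegenerateCracks L h)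
    (hg : g ∈ K L) (hη : g - h ∈ admissibleVariations L h) (ha : a ∈ crackFaces L h) :
    D L g a = 0 := by
  have h1 := D_eq_zero_of_mem_crackFaces hL hK hnd hη ha
  rw [D_sub_eq hg.1 hK.1 ha.1.1, ha.1.2, sub_zero] at h1
  exact h1

lemma abs_cutGrad_sub_le (ha0 : 0 ≤ a) (hbL : b ≤ L) {s : ℝ} (hs : 0 ≤ s)
    (hclose : ∀ y ∈ Icc 0 L, |D L g y - D L h y| ≤ s) (y : ℝ) :
    |cutGrad L g a b y - cutGrad L h a b y| ≤ s := by
  unfold cutGrad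
  by_cases hy : y ∈ Icc a b
  · rw [indicator_of_mem hy, indicator_of_mem hy]
    exact hclose y ⟨ha0.trans hy.1, hy.2.trans hbL⟩
  · rw [indicator_of_notMem hy, indicator_of_notMem hy]; simpa using hs

lemma integral_density_cut (ha0 : 0 ≤ a) (hab : a ≤ b) (hbL : b ≤ L) :
    ∫ y in (0 : ℝ)..L, density W ε (cutGrad L g a b) (cutHess L g a b) y =
      ∫ y in a..b, density W ε (D L g) (D L (D L g)) y := by
  rw [density_cut, integral_indicator_Icc ha0 hab hbL]

/-- Without a translation mode, the cut-off gradient of a better deformation is a competitor. -/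
lemma isCompetitor_cutGrad (hL : 0 < L) (hK : h ∈ K L) (hnd : NondegenerateCracks L h)
    (hg : g ∈ K L) (hη : g - h ∈ admissibleVariations L h) (ha0 : 0 ≤ a) (hab : a < b) (hbL : b ≤ L)
    (ha : a = 0 ∨ a ∈ crackFaces L h) (hb : b = L ∨ b ∈ crackFaces L h)
    (hnot : ¬ (a ∈ crackFaces L h ∧ b ∈ crackFaces L h)) {e : ℝ} (he : 0 ≤ e)
    (hclose : ∀ y ∈ Icc 0 L, |D L g y - D L h y| ≤ e)
    (hlt : ∫ y in a..b, density W ε (D L g) (D L (D L g)) y <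
      ∫ y in a..b, density W ε (D L h) (D L (D L h)) y) :
    IsCompetitor W ε L h a b e (cutGrad L g a b) (cutHess L g a b) where
  memH1 := cutGrad_memH1 hL hg.1 ha0 hab hbL
    (ha.imp_right (D_eq_zero_of_crackFace hL hK hnd hg hη))
    (hb.imp_right (D_eq_zero_of_crackFace hL hK hnd hg hη))
  nonneg := fun _ hy => cutGrad_nonneg hg a b hy
  integral_eq := by
    rw [cutGrad, cutGrad, integral_indicator_Icc ha0 hab.le hbL,
      integral_indicator_Icc ha0 hab.le hbL, integral_D_eq hL hg hK hη ha0 hab hbL ha hb]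
  off := fun _ _ hy => Or.inr ⟨indicator_of_notMem hy _, indicator_of_notMem hy _⟩
  close := fun y _ => abs_cutGrad_sub_le ha0 hbL he hclose y
  support := fun y _ hy => indicator_of_notMem
    (fun hm => hy ⟨by linarith [hm.1], by linarith [hm.2]⟩) _
  energy_lt := by
    rwa [integral_density_cut ha0 hab.le hbL, integral_density_cut ha0 hab.le hbL]
  orthogonal := fun h1 h2 => absurd ⟨h1, h2⟩ hnot

/-- Between two cracks, a translate of the cut-off gradient of a better deformation is a
competitor. -/
lemma exists_isCompetitor_shift (hL : 0 < L) (hK : h ∈ K L) (hnd : NondegenerateCracks L h)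
    (hab : IsUnbrokenPart L h a b) {e : ℝ} (he : 0 < e) :
    ∃ s > 0, ∀ g ∈ K L, g - h ∈ admissibleVariations L h →
      (∀ y ∈ Icc 0 L, |D L g y - D L h y| ≤ s) →
      ∫ y in a..b, density W ε (D L g) (D L (D L g)) y <
        ∫ y in a..b, density W ε (D L h) (D L (D L h)) y →
      ∃ q z, IsCompetitor W ε L h a b e q z := by
  obtain ⟨ρ₀, hρ₀, hBl, hBr⟩ := hab.exists_margin hnd
  obtain ⟨ha, hb, hlt, hgood⟩ := hab
  have ha' := crackFaces_subset_Ioo hnd ha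
  have hb' := crackFaces_subset_Ioo hnd hb
  have hρa : 0 ≤ a - ρ₀ := (hBl ⟨le_rfl, by linarith⟩).1.1
  have hρb : b + ρ₀ ≤ L := (hBr ⟨by linarith, le_rfl⟩).1.2
  have hcont : ∀ g, MemH2 L g → D L g a = 0 → D L g b = 0 → Continuous (cutGrad L g a b) := by
    intro g hg hga hgb
    have h1 : cutGrad L g a b = fun y => ∫ t in (0 : ℝ)..y, cutHess L g a b t :=
      funext ((hg.memH1 hL).indicator_eq_integral hL.le ha'.1 hlt.le hb'.2 hga hgb)
    rw [h1]
    exact intervalIntegral.continuous_primitive (intervalIntegrable_of_memLp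
      (memLp_indicator (hg.memH1 hL).memLp ha'.1.le hb'.2.le)) 0
  have hPc := hcont h hK.1 ha.1.2 hb.1.2
  have hsuppP : ∀ y, y ∉ Ioo a b → cutGrad L h a b y = 0 := by
    intro y hy
    rw [← translationMode_eq_cutGrad ⟨ha, hb, hlt, hgood⟩]
    exact indicator_of_notMem hy _
  have hposP : ∀ y ∈ Ioo a b, 0 < cutGrad L h a b y := by
    intro y hy
    have hyg := hgood hy
    rw [cutGrad, indicator_of_mem (Ioo_subset_Icc_self hy)]
    exact (hK.2.2.2 y hyg.1).lt_of_ne fun h0 => hyg.2 ⟨hyg.1, h0.symm⟩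
  have hP0 : ∀ y, 0 ≤ cutGrad L h a b y := fun y => by
    by_cases hy : y ∈ Ioo a b
    · exact (hposP y hy).le
    · exact (hsuppP y hy).ge
  obtain ⟨ρ₁, hρ₁, hunif⟩ := Metric.uniformContinuousOn_iff.1
    ((isCompact_Icc (a := -ρ₀) (b := L + ρ₀)).uniformContinuousOn_of_continuous hPc.continuousOn)
    (e / 2) (by linarith)
  -- The three bounds keep the translate in the broken margins, its support within `e` of `[a,b]`,
  -- and `P(·+τ)` within `e/2` of `P`; the other `e/2` is for the distance of `g'` from `h'`.
  set ρ := min ρ₀ (min (e / 2) (ρ₁ / 2)) with hρdef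
  have hρ : 0 < ρ := lt_min hρ₀ (lt_min (by linarith) (by linarith))
  have hρ₀' : ρ ≤ ρ₀ := min_le_left _ _
  have hρe : ρ ≤ e / 2 := (min_le_right _ _).trans (min_le_left _ _)
  have hρ₁' : ρ ≤ ρ₁ / 2 := (min_le_right _ _).trans (min_le_right _ _)
  obtain ⟨s, hs, hshift⟩ := exists_shift_orthogonal hPc hP0 hsuppP hposP hlt hρ (by linarith) hb'.2.le
  refine ⟨min s (e / 2), lt_min hs (by linarith), fun g hg hη hclose hlow => ?_⟩
  have hga := D_eq_zero_of_crackFace hL hK hnd hg hη ha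
  have hgb := D_eq_zero_of_crackFace hL hK hnd hg hη hb
  have hQP := abs_cutGrad_sub_le (h := h) (g := g) ha'.1.le hb'.2.le
    (lt_min hs (by linarith : 0 < e / 2)).le hclose
  obtain ⟨τ, hτ, horth⟩ := hshift (cutGrad L g a b) (hcont g hg.1 hga hgb)
    fun y => (hQP y).trans (min_le_left _ _)
  have hτ' := abs_le.1 hτ
  refine ⟨fun y => cutGrad L g a b (y + τ), fun y => cutHess L g a b (y + τ),
    (hg.1.memH1 hL).indicator_shift hL.le ha'.1 hlt.le hb'.2 hga hgb τ, ?_, ?_, ?_, ?_, ?_, ?_, ?_⟩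
  · intro y _
    unfold cutGrad
    exact indicator_nonneg (fun t ht => hg.2.2.2 t ⟨ha'.1.le.trans ht.1, ht.2.trans hb'.2.le⟩) _
  · unfold cutGrad
    rw [integral_indicator_shift hlt.le (by linarith) (by linarith),
      integral_indicator_Icc ha'.1.le hlt.le hb'.2.le,
      integral_D_eq hL hg hK hη ha'.1.le hlt hb'.2.le (Or.inr ha) (Or.inr hb)]
  · exact fun y _ hy => shift_off hBl hBr (hτ.trans hρ₀') _ _ hy
  · intro y hy
    have h1 := (hQP (y + τ)).trans (min_le_right _ _)
    have h2 := hunif (y + τ) ⟨by linarith [hy.1], by linarith [hy.2]⟩ y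
      ⟨by linarith [hy.1], by linarith [hy.2]⟩ (by
        rw [Real.dist_eq, add_sub_cancel_left]; linarith)
    rw [Real.dist_eq] at h2
    have h3 := abs_sub_le (cutGrad L g a b (y + τ)) (cutGrad L h a b (y + τ)) (cutGrad L h a b y)
    linarith
  · intro y _ hy
    exact indicator_of_notMem (fun hm => hy ⟨by linarith [hm.1], by linarith [hm.2]⟩) _
  · have h1 : ∀ y, density W ε (fun y => cutGrad L g a b (y + τ))
        (fun y => cutHess L g a b (y + τ)) y =
        density W ε (cutGrad L g a b) (cutHess L g a b) (y + τ) := fun y => rfl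
    simp_rw [h1]
    rwa [density_cut, integral_indicator_shift hlt.le (by linarith) (by linarith),
      integral_density_cut ha'.1.le hlt.le hb'.2.le]
  · exact fun _ _ => horth

/-- Local minimality on a single unbroken interval. -/
lemma exists_gap_stable (hW : ContDiffOn ℝ 2 (Wstar W) (Ici 0)) (hε : 0 < ε) (hL : 0 < L)
    (hK : h ∈ K L) (hEL : SolvesEL W ε L h) (hnd : NondegenerateCracks L h)
    (hpos : PositiveModuloTranslations W ε L h) (ha0 : 0 ≤ a) (hab : a < b) (hbL : b ≤ L)
    (ha : a = 0 ∨ a ∈ crackFaces L h) (hb : b = L ∨ b ∈ crackFaces L h)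
    (hg : Ioo a b ⊆ good L h) :
    ∃ δ > 0, ∀ g ∈ K L, g - h ∈ admissibleVariations L h → H2norm L (g - h) < δ →
      ∫ y in a..b, density W ε (D L h) (D L (D L h)) y ≤
        ∫ y in a..b, density W ε (D L g) (D L (D L g)) y := by
  obtain ⟨e, he, hno⟩ := exists_no_competitor hW hε hL hK hEL hnd hpos ha0 hab hbL ha hb hg
  obtain ⟨κ, hκ, hsup⟩ := exists_D_le_H2norm hL
  obtain ⟨s, hs, hcomp⟩ : ∃ s > 0, ∀ g ∈ K L, g - h ∈ admissibleVariations L h →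
      (∀ y ∈ Icc 0 L, |D L g y - D L h y| ≤ s) →
      ∫ y in a..b, density W ε (D L g) (D L (D L g)) y <
        ∫ y in a..b, density W ε (D L h) (D L (D L h)) y →
      ∃ q z, IsCompetitor W ε L h a b e q z := by
    by_cases hboth : a ∈ crackFaces L h ∧ b ∈ crackFaces L h
    · exact exists_isCompetitor_shift hL hK hnd ⟨hboth.1, hboth.2, hab, hg⟩ he
    · exact ⟨e, he, fun g hgK hη hclose hlt => ⟨_, _, isCompetitor_cutGrad hL hK hnd hgK hη ha0 hab
        hbL ha hb hboth he.le hclose hlt⟩⟩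
  refine ⟨s / κ, by positivity, fun g hgK hη hδ => ?_⟩
  by_contra hlt
  obtain ⟨q, z, hqz⟩ := hcomp g hgK hη (fun y hy => by
    rw [← D_sub_eq hgK.1 hK.1 hy]
    refine (hsup _ hη.1.1 y hy).trans ?_
    rw [lt_div_iff₀ hκ] at hδ
    linarith) (not_le.1 hlt)
  exact hno q z hqz

/-- On a broken interval the energy density of `h` vanishes almost everywhere, while that of any
deformation in `K` is nonnegative. -/
lemma integral_density_le_of_broken {γ : ℝ} (hWb : IsBrittleEnergy W γ) (hL : 0 < L) (hK : h ∈ K L)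
    (hnd : NondegenerateCracks L h) (hg : g ∈ K L) (ha0 : 0 ≤ a) (hab : a < b) (hbL : b ≤ L)
    (hbr : Ioo a b ⊆ broken L h) :
    ∫ y in a..b, density W ε (D L h) (D L (D L h)) y ≤
      ∫ y in a..b, density W ε (D L g) (D L (D L g)) y := by
  have h1 : ∫ y in a..b, density W ε (D L h) (D L (D L h)) y = 0 := by
    rw [intervalIntegral.integral_of_le hab.le, integral_Ioc_eq_integral_Ioo]
    apply integral_eq_zero_of_ae
    have h2 := ae_restrict_of_ae_restrict_of_subset
      (Ioo_subset_Icc_self.trans (Icc_subset_Icc ha0 hbL)) (ae_D_D_eq_zero hL hK hnd)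
    filter_upwards [h2, ae_restrict_mem measurableSet_Ioo] with y hy hy'
    simp [density, hy (hbr hy'), (hbr hy').2, Wstar_zero]
  rw [h1]
  refine intervalIntegral.integral_nonneg hab.le fun y hy => ?_
  have := Wstar_nonneg hWb (hg.2.2.2 y ⟨ha0.trans hy.1, hy.2.trans hbL⟩)
  unfold density
  positivity

/-- Positivity of the second variation modulo translations implies local stability. -/
lemma locallyStable_of_positive {γ : ℝ} (hWb : IsBrittleEnergy W γ)
    (hW : ContDiffOn ℝ 2 (Wstar W) (Ici 0)) (hε : 0 < ε) (hL : 0 < L)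
    (hK : h ∈ K L) (hEL : SolvesEL W ε L h) (hnd : NondegenerateCracks L h)
    (hpos : PositiveModuloTranslations W ε L h) : LocallyStable W ε L h := by
  have hfin := finite_crackFaces hL hK hnd
  -- There are finitely many pairs of possible end points, so one radius serves all unbroken
  -- intervals; the remaining pairs satisfy the claim vacuously.
  have hev : ∀ᶠ δ in 𝓝[>] (0 : ℝ), ∀ x ∈ insert 0 (crackFaces L h) ×ˢ insert L (crackFaces L h),
      x.1 < x.2 → Ioo x.1 x.2 ⊆ good L h →
      ∀ g ∈ K L, g - h ∈ admissibleVariations L h → H2norm L (g - h) < δ →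
        ∫ y in x.1..x.2, density W ε (D L h) (D L (D L h)) y ≤
          ∫ y in x.1..x.2, density W ε (D L g) (D L (D L g)) y := by
    rw [eventually_all_finite ((hfin.insert 0).prod (hfin.insert L))]
    rintro ⟨a, b⟩ ⟨ha, hb⟩
    by_cases hgap : a < b ∧ Ioo a b ⊆ good L h
    · have ha0 : 0 ≤ a := by
        rcases ha with rfl | ha
        · exact le_rfl
        · exact ha.1.1.1
      have hbL : b ≤ L := by
        rcases hb with rfl | hb
        · exact le_rfl
        · exact hb.1.1.2
      obtain ⟨δ, hδ, hst⟩ := exists_gap_stable hW hε hL hK hEL hnd hpos ha0 hgap.1 hbL ha hb hgap.2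
      filter_upwards [Ioo_mem_nhdsGT hδ] with d hd _ _ g hg hη hlt
      exact hst g hg hη (hlt.trans hd.2)
    · exact Eventually.of_forall fun d h1 h2 => absurd ⟨h1, h2⟩ hgap
  obtain ⟨δ, hst, hδ⟩ := (hev.and self_mem_nhdsWithin).exists
  refine ⟨δ, hδ, fun g hg hη hlt => ?_⟩
  by_contra hbad
  -- Summation over the intervals as a minimal counterexample: at the first crack face (or at `L`)
  -- where the energy inequality up to that point fails, it still holds at the preceding one, and
  -- the interval between them adds a correct inequality.
  set bad : Set ℝ := {y ∈ insert L (crackFaces L h) |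
    ¬ ∫ t in (0 : ℝ)..y, density W ε (D L h) (D L (D L h)) t ≤
      ∫ t in (0 : ℝ)..y, density W ε (D L g) (D L (D L g)) t} with hbaddef
  have hbadfin : bad.Finite := (hfin.insert L).subset fun y hy => hy.1
  obtain ⟨y, ⟨hy, hynot⟩, hmin⟩ := Set.exists_min_image bad id hbadfin ⟨L, mem_insert _ _, hbad⟩
  have hy0 : 0 < y := by
    rcases hy with rfl | hy
    · exact hL
    · exact (crackFaces_subset_Ioo hnd hy).1
  have hyL : y ≤ L := by
    rcases hy with rfl | hy
    · exact le_rfl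
    · exact hy.1.1.2
  obtain ⟨x, hx, hx0, hxy, hC⟩ := exists_prev hL hK hnd hy0
  have hprev : ∫ t in (0 : ℝ)..x, density W ε (D L h) (D L (D L h)) t ≤
      ∫ t in (0 : ℝ)..x, density W ε (D L g) (D L (D L g)) t := by
    rcases hx with rfl | hx
    · simp
    · by_contra hnot
      exact absurd (hmin x ⟨mem_insert_of_mem _ hx, hnot⟩) (not_le.2 hxy)
  have hgap : ∫ t in x..y, density W ε (D L h) (D L (D L h)) t ≤
      ∫ t in x..y, density W ε (D L g) (D L (D L g)) t := by
    rcases Ioo_subset_broken_or_good hL hK hx0 hyL hC with hbr | hgd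
    · exact integral_density_le_of_broken hWb hL hK hnd hg hx0 hxy hyL hbr
    · exact hst (x, y) ⟨hx, hy⟩ hxy hgd g hg hη hlt
  have hsplit : ∀ f ∈ K L, ∫ t in (0 : ℝ)..y, density W ε (D L f) (D L (D L f)) t =
      (∫ t in (0 : ℝ)..x, density W ε (D L f) (D L (D L f)) t) +
        ∫ t in x..y, density W ε (D L f) (D L (D L f)) t := by
    intro f hf
    have hi := intervalIntegrable_density (ε := ε) hW hL.le (hf.1.memH1 hL) hf.2.2.2
    have hxm : x ∈ uIcc 0 L := by rw [uIcc_of_le hL.le]; exact ⟨hx0, hxy.le.trans hyL⟩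
    have hym : y ∈ uIcc 0 L := by rw [uIcc_of_le hL.le]; exact ⟨hy0.le, hyL⟩
    exact (intervalIntegral.integral_add_adjacent_intervals
      (hi.mono_set (uIcc_subset_uIcc left_mem_uIcc hxm))
      (hi.mono_set (uIcc_subset_uIcc hxm hym))).symm
  apply hynot
  rw [hsplit h hK, hsplit g hg]
  exact add_le_add hprev hgap

end gap

end InverseFracture
end

open InverseFracture in
theorem theorem3p5 (W : ℝ → ℝ) (γ ε L : ℝ) (hW : IsBrittleEnergy W γ)
    (hWstar : ContDiffOn ℝ 2 (Wstar W) (Set.Ici 0)) (hε : 0 < ε) (hL : 0 < L)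
    (h : ℝ → ℝ) (hK : h ∈ K L) (hEL : SolvesEL W ε L h) (hnd : NondegenerateCracks L h) :
    (∀ r s, IsUnbrokenPart L h r s → translationMode L h r s ∈ restrictedVariations L h) ∧
    ((∀ η ∈ restrictedVariations L h, (∃ y ∈ Set.Icc 0 L, η y ≠ 0) →
        (∀ r s, IsUnbrokenPart L h r s →
          ∫ y in (0 : ℝ)..L, η y * translationMode L h r s y = 0) →
        0 < secondVariation W ε L h η) →
      LocallyStable W ε L h) :=
  ⟨fun _ _ hrs => translationMode_mem hWstar hε hL hK hEL hnd hrs,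
    fun hpos => locallyStable_of_positive hW hWstar hε hL hK hEL hnd hpos⟩
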